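/- **Setting.** Let $(M,g)$ be a complete smooth Riemannian manifold of dimension $n\ge 1$ and $\gamma:\mathbb R\to M$ a geodesic parametrized by arc length. Let $(e_1,\dots,e_n)$ be the frame along $\gamma$ obtained by parallel transport of an orthonormal basis of $T_{\gamma(0)}M$ with $e_1(0)=\dot\gamma(0)$, and let $$\exp^\perp(x^1,\vec x)=\exp_{\gamma(x^1)}\Big(\sum_{m=2}^n x^m e_m(x^1)\Big),\qquad \vec x=(x^2,\dots,x^n)\in\mathbb R^{n-1}.$$ Let $r_{\rm foc}\in[0,\infty]$ be the focal radius of $\gamma$, the largest radius such that $\exp^\perp$ has no critical point (is a local diffeomorphism) on $\{|\vec x|<r_{\rm foc}\}$, and put $\mathcal N=\{|\vec x|<r_{\rm foc}\}$. Equip $\mathbb R\times\mathcal N$ with the pull-back metric $(\exp^\perp)^*g$; let $\Gamma^i_{jk}$ be its Christoffel symbols and $R_{abcl}=\langle R(\partial_a,\partial_b)\partial_c,\partial_l\rangle$, $R(X,Y)=\nabla_X\nabla_Y-\nabla_Y\nabla_X-\nabla_{[X,Y]}$, its curvature components (geodesic normal, or Fermi, coordinates). On $\mathbb R^{1+d}$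 let $\mathfrak m=\mathrm{diag}(-1,1,\dots,1)$ and $\Box=\mathfrak m^{\mu\nu}\partial_\mu\partial_\nu$; let $\ell:\mathbb R^{1+d}\to\mathbb R$ be linear and $\sigma=\mathfrak m(d\ell,d\ell)$. For a tuple $A=(A_1,\dots,A_q)$ in $\{1,\dots,n\}$ write $|A|=q$, $\partial_A=\partial_{A_1}\cdots\partial_{A_q}$, $\boldsymbol u^A=u^{A_1}\cdots u^{A_q}$. Repeated indices $j,k$ are summed over $1,\dots,n$. **Proposition.** (a) If $r_{\rm foc}>0$, then for all $q\ge 0$, all $i,j,k$ and all $s\in\mathbb R$, $\partial_1^q\Gamma^i_{jk}(s,\vec 0)=0$. (b) There are functions $h^i(s,\boldsymbol u,p)$, $1\le i\le n$, smooth on $\{s\in\mathbb R,\ \boldsymbol u\in\mathbb R\times\mathcal N,\ p\in\mathbb R^{n(d+1)}\}$, with the following property. Let $\boldsymbol u=(u^1,\vec u)$ be an $\mathbb R^n$-valued map on $\mathbb R^{1+d}$, of class $C^2$ near a point, with value in $\mathbb R\times\mathcal N$ at that point. Then at that point the wave map equations $$\Box\phi^i+\Gamma^i_{jk}(\phi)\,\mathfrak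 m(d\phi^j,d\phi^k)=0,\qquad \phi=(\ell+u^1,\vec u),$$ are equivalent, component by component, to the wave equation ($i=1$) $$\begin{aligned}\Box u^1=&-2\sum_{m=2}^nR_{m1j1}(\ell,\vec0)\,u^m\,\mathfrak m(du^j,d\ell)-\sum_{|A|=2,\,A\ne(1,1)}\tfrac1{2!}\partial_A\Gamma^1_{11}(\ell,\vec0)\,\boldsymbol u^A\sigma\\&-\sum_{m=2}^n\partial_m\Gamma^1_{jk}(\ell,\vec0)\,u^m\,\mathfrak m(du^j,du^k)-2\sum_{|A|=2,\,A\ne(1,1)}\tfrac1{2!}\partial_A\Gamma^1_{j1}(\ell,\vec0)\,\boldsymbol u^A\,\mathfrak m(du^j,d\ell)\\&-\sum_{|A|=3,\,A\ne(1,1,1)}\tfrac1{3!}\partial_A\Gamma^1_{11}(\ell,\vec0)\,\boldsymbol u^A\sigma+h^1(\ell,\boldsymbol u,\partial\boldsymbol u)\end{aligned}$$ and the Klein–Gordon type equations ($2\le i\le n$) $$\begin{aligned}\Box u^i+\sum_{m=2}^nR_{m11i}(\ell,\vec0)\,u^m\sigma=&-2\sum_{m=2}^nR_{m1ji}(\ell,\vec0)\,u^m\,\mathfrak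 m(du^j,d\ell)-\sum_{|A|=2,\,A\ne(1,1)}\tfrac1{2!}\partial_A\Gamma^i_{11}(\ell,\vec0)\,\boldsymbol u^A\sigma\\&-\sum_{m=2}^n\partial_m\Gamma^i_{jk}(\ell,\vec0)\,u^m\,\mathfrak m(du^j,du^k)-2\sum_{|A|=2,\,A\ne(1,1)}\tfrac1{2!}\partial_A\Gamma^i_{j1}(\ell,\vec0)\,\boldsymbol u^A\,\mathfrak m(du^j,d\ell)\\&-\sum_{|A|=3,\,A\ne(1,1,1)}\tfrac1{3!}\partial_A\Gamma^i_{11}(\ell,\vec0)\,\boldsymbol u^A\sigma+h^i(\ell,\boldsymbol u,\partial\boldsymbol u).\end{aligned}$$ (c) The $h^i$ are of higher order: there are a continuous function $C:\mathbb R\to\mathbb R$ and a function $f(\boldsymbol u,p)$, smooth on $(\mathbb R\times\mathcal N)\times\mathbb R^{n(d+1)}$, with $$|h^i(s,\boldsymbol u,p)|\le C(s)\,(|\boldsymbol u|^4+|p|^4)\,f(\boldsymbol u,p)$$ for all $i$ and all $(s,\boldsymbol u,p)$ in the domain. If for every $\rho<r_{\rm foc}$ the derivatives of the $\Gamma^i_{jk}$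 of orders $2,3,4$ are bounded on $\{|\vec x|\le\rho\}$, then $C$ can be taken constant. -/

import Mathlib

open scoped ContDiff Manifold

noncomputable section

namespace FermiWaveMap

/-- Coordinate space `ℝⁿ` with its Euclidean norm. -/
abbrev V (n : ℕ) : Type := EuclideanSpace ℝ (Fin n)

/-- The `i`-th coordinate vector of `ℝⁿ`. -/
def basisVec {n : ℕ} (i : Fin n) : V n := EuclideanSpace.single i (1 : ℝ)

/-- The partial derivative `∂ᵢ f` at `x`. -/
def pderiv {n : ℕ} (i : Fin n) (f : V n → ℝ) (x : V n) : ℝ := fderiv ℝ f x (basisVec i)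

/-- The iterated partial derivative `∂_A f = ∂_{A₁} ⋯ ∂_{A_q} f` at `x`, for a `q`-tuple `A`. -/
def multiDeriv {n q : ℕ} (A : Fin q → Fin n) (f : V n → ℝ) (x : V n) : ℝ :=
  iteratedFDeriv ℝ q f x (fun a => basisVec (A a))

/-! ### Christoffel symbols and curvature of a metric given by its coefficients -/

/-- The Christoffel symbol `Γⁱ_{jk}` of the metric with coefficient matrix `G` on a domain
of `ℝⁿ`. -/
def christoffel {n : ℕ} (G : V n → Matrix (Fin n) (Fin n) ℝ) (i j k : Fin n) (x : V n) : ℝ :=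
  (1 / 2) * ∑ l, (G x)⁻¹ i l *
    (pderiv j (fun z => G z k l) x + pderiv k (fun z => G z j l) x - pderiv l (fun z => G z j k) x)

/-- The curvature component `R_{abcl} = ⟨R(∂_a, ∂_b) ∂_c, ∂_l⟩`, with
`R(X, Y) = ∇_X ∇_Y - ∇_Y ∇_X - ∇_[X,Y]`. -/
def riemann {n : ℕ} (G : V n → Matrix (Fin n) (Fin n) ℝ) (a b c l : Fin n) (x : V n) : ℝ :=
  ∑ p, G x l p *
    (pderiv a (christoffel G p b c) x - pderiv b (christoffel G p a c) x
      + ∑ q, (christoffel G q b c x * christoffel G p a q x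
          - christoffel G q a c x * christoffel G p b q x))

/-! ### Geodesics, parallel fields and the exponential map of a Riemannian manifold -/

section Manifold

variable {n : ℕ} {M : Type*} [TopologicalSpace M] [ChartedSpace (V n) M] [IsManifold (𝓡 n) ∞ M]

/-- Smooth Riemannian metrics on the `n`-dimensional manifold `M`. -/
abbrev Metric (n : ℕ) (M : Type*) [TopologicalSpace M] [ChartedSpace (V n) M]
    [IsManifold (𝓡 n) ∞ M] :=
  Bundle.ContMDiffRiemannianMetric (𝓡 n) ∞ (V n) (fun x : M => TangentSpace (𝓡 n) x)

/-- The coefficient matrix `⟨dF(∂ᵢ), dF(∂ⱼ)⟩_g` of the pull-back of `g` along `F : ℝⁿ → M`. For `F`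
the inverse of a chart this is the metric in local coordinates. -/
def pullbackMetric (g : Metric n M) (F : V n → M) (x : V n) : Matrix (Fin n) (Fin n) ℝ :=
  fun i j => g.inner (F x) (mfderiv (𝓡 n) (𝓡 n) F x (basisVec i))
    (mfderiv (𝓡 n) (𝓡 n) F x (basisVec j))

/-- The velocity of the curve `c` at time `t`. -/
def velocity (c : ℝ → M) (t : ℝ) : TangentSpace (𝓡 n) (c t) :=
  mfderiv 𝓘(ℝ, ℝ) (𝓡 n) c t (1 : ℝ)

/-- `c : ℝ → M` is a geodesic: it is smooth and solves the geodesic equation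
`c̈ⁱ + Γⁱ_{jk}(c) ċʲ ċᵏ = 0` in every local coordinate system. -/
def IsGeodesic (g : Metric n M) (c : ℝ → M) : Prop :=
  ContMDiff 𝓘(ℝ, ℝ) (𝓡 n) ∞ c ∧
  ∀ χ ∈ IsManifold.maximalAtlas (𝓡 n) ∞ M, ∀ t : ℝ, c t ∈ χ.source → ∀ i : Fin n,
    deriv (deriv (fun s => χ (c s) i)) t
      + ∑ j, ∑ k, christoffel (pullbackMetric g χ.symm) i j k (χ (c t))
          * deriv (fun s => χ (c s) j) t * deriv (fun s => χ (c s) k) t = 0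

/-- The components, in the chart `χ`, of a vector field `W` along the curve `c`. -/
def chartComponents (χ : OpenPartialHomeomorph M (V n)) (c : ℝ → M)
    (W : ∀ t, TangentSpace (𝓡 n) (c t)) (t : ℝ) : V n :=
  mfderiv (𝓡 n) (𝓡 n) χ (c t) (W t)

/-- `W` is parallel along `c`: in every local coordinate system
`Ẇⁱ + Γⁱ_{jk}(c) ċʲ Wᵏ = 0`. -/
def IsParallel (g : Metric n M) (c : ℝ → M) (W : ∀ t, TangentSpace (𝓡 n) (c t)) : Prop :=
  ∀ χ ∈ IsManifold.maximalAtlas (𝓡 n) ∞ M, ∀ t : ℝ, c t ∈ χ.source → ∀ i : Fin n,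
    HasDerivAt (fun s => chartComponents χ c W s i)
      (-∑ j, ∑ k, christoffel (pullbackMetric g χ.symm) i j k (χ (c t))
          * deriv (fun s => χ (c s) j) t * chartComponents χ c W t k) t

/-- `c` is a geodesic with initial point and initial velocity `w`. -/
def IsGeodesicFrom (g : Metric n M) (w : TangentBundle (𝓡 n) M) (c : ℝ → M) : Prop :=
  IsGeodesic g c ∧ (⟨c 0, velocity c 0⟩ : TangentBundle (𝓡 n) M) = w

/-- `(M, g)` is complete: geodesics with arbitrary initial data exist for all time. -/
def IsComplete (g : Metric n M) : Prop :=
  ∀ w : TangentBundle (𝓡 n) M, ∃ c : ℝ → M, IsGeodesicFrom g w c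

open Classical in
/-- The exponential map: the point at time `1` of the geodesic with initial data `w`. (The value
for initial data without a global geodesic is irrelevant on a complete manifold.) -/
def expMap (g : Metric n M) (w : TangentBundle (𝓡 n) M) : M :=
  if h : ∃ c : ℝ → M, IsGeodesicFrom g w c then h.choose 1 else w.proj

end Manifold

/-! ### Geodesic normal (Fermi) coordinates

The dimension of `M` is `k + 1`; the index `0 : Fin (k + 1)` is the direction of the geodesic and
the indices `m.succ`, `m : Fin k`, are the normal directions. -/

section Fermi

variable {k : ℕ} {M : Type*} [TopologicalSpace M] [ChartedSpace (V (k + 1)) M]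
  [IsManifold (𝓡 (k + 1)) ∞ M]

/-- The normal part `x⃗` of `x = (x¹, x⃗)`. -/
def normalPart (x : V (k + 1)) : V k := WithLp.toLp 2 (fun m : Fin k => x m.succ)

/-- The point `(s, 0⃗)`. -/
def axisPoint (s : ℝ) : V (k + 1) := EuclideanSpace.single 0 s

/-- `e` is a frame along `γ` obtained by parallel transport of an orthonormal basis of
`T_{γ(0)} M` whose first vector is `γ̇(0)`. -/
structure IsFermiFrame (g : Metric (k + 1) M) (γ : ℝ → M)
    (e : Fin (k + 1) → ∀ t, TangentSpace (𝓡 (k + 1)) (γ t)) : Prop where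
  parallel : ∀ i, IsParallel g γ (e i)
  first : e 0 0 = velocity γ 0
  orthonormal : ∀ i j, g.inner (γ 0) (e i 0) (e j 0) = if i = j then 1 else 0

/-- The normal exponential map `(x¹, x⃗) ↦ exp_{γ(x¹)} (∑_{m ≥ 2} xᵐ e_m(x¹))`. -/
def normalExp (g : Metric (k + 1) M) (γ : ℝ → M)
    (e : Fin (k + 1) → ∀ t, TangentSpace (𝓡 (k + 1)) (γ t)) (x : V (k + 1)) : M :=
  expMap g ⟨γ (x 0), ∑ m : Fin k, x m.succ • e m.succ (x 0)⟩

/-- The focal radius of `γ`: the largest radius (possibly infinite) such that the normal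
exponential map has no critical point on the normal disc bundle of that radius, that is, it is a
local diffeomorphism at each of its points. -/
def focalRadius (g : Metric (k + 1) M) (γ : ℝ → M)
    (e : Fin (k + 1) → ∀ t, TangentSpace (𝓡 (k + 1)) (γ t)) : ENNReal :=
  sSup {r : ENNReal | ∀ x : V (k + 1), ‖normalPart x‖ₑ < r →
    IsLocalDiffeomorphAt (𝓡 (k + 1)) (𝓡 (k + 1)) ∞ (normalExp g γ e) x}

/-- The coordinate domain `ℝ × 𝒩`, `𝒩 = {x⃗ : |x⃗| < r_foc}`. -/
def fermiDomain (g : Metric (k + 1) M) (γ : ℝ → M)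
    (e : Fin (k + 1) → ∀ t, TangentSpace (𝓡 (k + 1)) (γ t)) : Set (V (k + 1)) :=
  {x | ‖normalPart x‖ₑ < focalRadius g γ e}

/-- The coefficients of `g` in the geodesic normal coordinates. -/
def fermiMetric (g : Metric (k + 1) M) (γ : ℝ → M)
    (e : Fin (k + 1) → ∀ t, TangentSpace (𝓡 (k + 1)) (γ t)) :
    V (k + 1) → Matrix (Fin (k + 1)) (Fin (k + 1)) ℝ :=
  pullbackMetric g (normalExp g γ e)

end Fermi

/-! ### Minkowski space `ℝ^{1+d}` and the equations -/

/-- The Minkowski inner product `diag(-1, 1, …, 1)` of covectors. -/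
def mink {d : ℕ} (a b : Fin (d + 1) → ℝ) : ℝ := -(a 0 * b 0) + ∑ μ : Fin d, a μ.succ * b μ.succ

/-- The differential `(∂_μ v)_μ` of a function on `ℝ^{1+d}`. -/
def grad {d : ℕ} (v : V (d + 1) → ℝ) (y : V (d + 1)) : Fin (d + 1) → ℝ := fun μ => pderiv μ v y

/-- The d'Alembertian `□ v = -∂₀² v + ∑ ∂_μ² v`. -/
def box {d : ℕ} (v : V (d + 1) → ℝ) (y : V (d + 1)) : ℝ :=
  -pderiv 0 (pderiv 0 v) y + ∑ μ : Fin d, pderiv μ.succ (pderiv μ.succ v) y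

/-- The `i`-th component at `y` of the wave map operator
`□ φⁱ + Γⁱ_{jk}(φ) 𝔪(dφʲ, dφᵏ)` into the target metric `G`. -/
def waveMapOp {n d : ℕ} (G : V n → Matrix (Fin n) (Fin n) ℝ) (φ : V (d + 1) → V n) (i : Fin n)
    (y : V (d + 1)) : ℝ :=
  box (fun z => φ z i) y
    + ∑ j, ∑ l, christoffel G i j l (φ y) * mink (grad (fun z => φ z j) y) (grad (fun z => φ z l) y)

section Equations

variable {k d : ℕ}

/-- The perturbed map `φ = (ℓ + u¹, u⃗)`. -/
def perturbedMap (ell : V (d + 1) →ₗ[ℝ] ℝ) (u : V (d + 1) → V (k + 1)) (y : V (d + 1)) : V (k + 1) :=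
  axisPoint (ell y) + u y

/-- The differential `(∂_μ uⁱ)` of `u` at `y`. -/
def jet {n : ℕ} (u : V (d + 1) → V n) (y : V (d + 1)) : Fin n → Fin (d + 1) → ℝ :=
  fun i => grad (fun z => u z i) y

/-- `∑_{|A| = q, A ≠ (1,…,1)} (1/q!) ∂_A F(s, 0⃗) u^A`. -/
def mixedTaylor (q : ℕ) (F : V (k + 1) → ℝ) (s : ℝ) (u : V (k + 1)) : ℝ :=
  ∑ A : Fin q → Fin (k + 1) with A ≠ (fun _ => 0),
    ((q.factorial : ℝ))⁻¹ * multiDeriv A F (axisPoint s) * ∏ a, u (A a)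

/-- The explicit quadratic and cubic part of the `i`-th equation, in terms of `s = ℓ`, the values
`u`, the derivatives `p = ∂u` and the covector `dl = dℓ`. -/
def nonlinearity (G : V (k + 1) → Matrix (Fin (k + 1)) (Fin (k + 1)) ℝ) (dl : Fin (d + 1) → ℝ)
    (i : Fin (k + 1)) (s : ℝ) (u : V (k + 1)) (p : Fin (k + 1) → Fin (d + 1) → ℝ) : ℝ :=
  - 2 * (∑ m : Fin k, ∑ j, riemann G m.succ 0 j i (axisPoint s) * u m.succ * mink (p j) dl)
  - mixedTaylor 2 (christoffel G i 0 0) s u * mink dl dl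
  - (∑ m : Fin k, ∑ j, ∑ l,
      pderiv m.succ (christoffel G i j l) (axisPoint s) * u m.succ * mink (p j) (p l))
  - 2 * (∑ j, mixedTaylor 2 (christoffel G i j 0) s u * mink (p j) dl)
  - mixedTaylor 3 (christoffel G i 0 0) s u * mink dl dl

/-- The domain of the variables `(s, u, p)` standing for `(ℓ, u, ∂u)`, for `u` in the set `D`. -/
def jetDomain (d : ℕ) (D : Set (V (k + 1))) :
    Set (ℝ × V (k + 1) × (Fin (k + 1) → Fin (d + 1) → ℝ)) :=
  {z | z.2.1 ∈ D}

/-- The functions `h` are of higher order on `D` with coefficient `C`, a function of the parameter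
of the geodesic: `|hⁱ(s, u, p)| ≤ C(s) (|u|⁴ + |p|⁴) f(u, p)` with `f` smooth. -/
def IsHigherOrder (D : Set (V (k + 1))) (C : ℝ → ℝ)
    (h : Fin (k + 1) → ℝ × V (k + 1) × (Fin (k + 1) → Fin (d + 1) → ℝ) → ℝ) : Prop :=
  ∃ f : V (k + 1) × (Fin (k + 1) → Fin (d + 1) → ℝ) → ℝ,
    ContDiffOn ℝ ∞ f {w | w.1 ∈ D} ∧
    ∀ i, ∀ z ∈ jetDomain d D,
      |h i z| ≤ C z.1 * (‖z.2.1‖ ^ 4 + ‖z.2.2‖ ^ 4) * f z.2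

end Equations

end FermiWaveMap

end

/-! Index `0` is the direction of `γ`. In Fermi coordinates `γ` is the coordinate axis, the
geodesics issuing from `γ` in normal directions are straight rays, and the frame vectors have
constant components. On the axis, the geodesic equation of `γ` therefore gives `Γⁱ₀₀ = 0`, that of
all normal rays gives `Γⁱ_{ab} = 0` by polarization, and parallelism of the frame gives `Γⁱ₀ₐ = 0`
(`fermi_christoffel_axisPoint`). The rays are geodesics because of `expMap_smul`, which rests on
uniqueness of geodesics, `IsGeodesicFrom.unique`. Once `Γ` vanishes along the axis, so do all its
derivatives in the axis direction, which is (a); moreover the metric is stationary there, hence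
equal to the identity (`fermiMetric_axisPoint`).

For (b), insert `dφʲ = δʲ₀ dℓ + duʲ` and `□ℓ = 0`. The term `Γ(φ)(dφ, dφ)` splits into parts with
zero, one and two factors `du`, in which `Γ` is expanded at `(ℓ, 0⃗)` to order 3, 2 and 1. By (a) no
pure axis multi-index survives. The linear coefficients are curvatures, `∂ₘΓⁱ_{j0} = R_{m0ji}`
(`IsNormalAlongAxis.riemann_axis`). Since `∂ₘΓ⁰₀₀ = 0` on the axis, the tangential equation has no
mass term. The Taylor remainders form `h`.

For (c), the integral remainder bounds `h` by `|u|⁴ + |p|⁴` times the size of the derivatives of `Γ`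
of orders 2 to 4 on the segment from `(s, 0⃗)` to `(s, 0⃗) + u`. That segment depends on `s` and `u`
jointly; a compact exhaustion of the disc bundle separates the two variables
(`exists_product_majorant`). Bounds on closed disc bundles make the dependence on `s` disappear
(`exists_uniform_majorant`). -/

namespace FermiWaveMap

open Topology Filter

/-! ### Christoffel symbols of a coefficient matrix: locality, symmetry, smoothness. -/

section Coefficients

variable {n : ℕ} {G : V n → Matrix (Fin n) (Fin n) ℝ}

lemma pderiv_congr {i : Fin n} {f f' : V n → ℝ} {x : V n} (h : f =ᶠ[𝓝 x] f') :
    pderiv i f x = pderiv i f' x := by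
  rw [pderiv, pderiv, h.fderiv_eq]

lemma contDiffAt_pderiv {f : V n → ℝ} {x : V n} (hf : ContDiffAt ℝ ∞ f x) (i : Fin n) :
    ContDiffAt ℝ ∞ (pderiv i f) x :=
  (hf.fderiv_right (m := ∞) (by simp)).clm_apply contDiffAt_const

lemma christoffel_congr {G' : V n → Matrix (Fin n) (Fin n) ℝ} {x : V n} (h : G =ᶠ[𝓝 x] G')
    (i j k : Fin n) : christoffel G i j k x = christoffel G' i j k x := by
  have hp (a b c : Fin n) : pderiv a (fun z => G z b c) x = pderiv a (fun z => G' z b c) x :=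
    pderiv_congr (h.mono fun z hz => by simp only [hz])
  simp only [christoffel, hp, h.eq_of_nhds]

lemma christoffel_symm (hG : ∀ x i j, G x i j = G x j i) (i j k : Fin n) :
    christoffel G i j k = christoffel G i k j := by
  funext x
  simp only [christoffel]
  congr 1
  refine Finset.sum_congr rfl fun l _ => ?_
  rw [show (fun z => G z j k) = fun z => G z k j from funext fun z => hG z j k]
  ring

/-- Cramer's rule: determinant and adjugate are polynomials in the entries. -/
lemma contDiffAt_matrix_inv {x : V n} (hG : ∀ i j, ContDiffAt ℝ ∞ (fun z => G z i j) x)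
    (hdet : (G x).det ≠ 0) (i j : Fin n) : ContDiffAt ℝ ∞ (fun z => (G z)⁻¹ i j) x := by
  have hd : ContDiffAt ℝ ∞ (fun z => (G z).det) x := by
    simp only [Matrix.det_apply']
    refine ContDiffAt.sum fun σ _ => contDiffAt_const.mul ?_
    exact contDiffAt_prod fun a _ => hG _ _
  have ha : ContDiffAt ℝ ∞ (fun z => (G z).adjugate i j) x := by
    simp only [Matrix.adjugate_apply, Matrix.det_apply']
    refine ContDiffAt.sum fun σ _ => contDiffAt_const.mul ?_
    refine contDiffAt_prod fun a _ => ?_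
    by_cases h : σ a = j
    · subst h; simpa using contDiffAt_const
    · simpa [Matrix.updateRow_apply, h] using hG _ _
  have : (fun z => (G z)⁻¹ i j) = fun z => ((G z).det)⁻¹ * (G z).adjugate i j := by
    funext z
    simp [Matrix.inv_def, Ring.inverse_eq_inv']
  rw [this]
  exact (hd.inv hdet).mul ha

lemma contDiffAt_christoffel {x : V n} (hG : ∀ i j, ContDiffAt ℝ ∞ (fun z => G z i j) x)
    (hdet : (G x).det ≠ 0) (i j k : Fin n) : ContDiffAt ℝ ∞ (christoffel G i j k) x := by
  unfold christoffel
  refine contDiffAt_const.mul (ContDiffAt.sum fun l _ => ?_)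
  exact (contDiffAt_matrix_inv hG hdet i l).mul
    (((contDiffAt_pderiv (hG k l) j).add (contDiffAt_pderiv (hG j l) k)).sub
      (contDiffAt_pderiv (hG j k) l))

/-- Lowering the upper index of the Christoffel symbols. -/
lemma sum_mul_christoffel {x : V n} (hdet : (G x).det ≠ 0) (l j k : Fin n) :
    ∑ i, G x l i * christoffel G i j k x =
      (1 / 2) * (pderiv j (fun z => G z k l) x + pderiv k (fun z => G z j l) x
        - pderiv l (fun z => G z j k) x) := by
  have h : (G x) * (G x)⁻¹ = 1 := Matrix.mul_nonsing_inv _ (isUnit_iff_ne_zero.2 hdet)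
  have h' (m : Fin n) : ∑ i, G x l i * (G x)⁻¹ i m = if l = m then 1 else 0 := by
    rw [← Matrix.mul_apply, h, Matrix.one_apply]
  simp only [christoffel, Finset.mul_sum]
  rw [Finset.sum_comm]
  have : ∀ m, ∑ i, G x l i * (1 / 2 * ((G x)⁻¹ i m *
      (pderiv j (fun z => G z k m) x + pderiv k (fun z => G z j m) x
        - pderiv m (fun z => G z j k) x))) = (if l = m then 1 else 0) * (1 / 2 *
      (pderiv j (fun z => G z k m) x + pderiv k (fun z => G z j m) x
        - pderiv m (fun z => G z j k) x)) := by
    intro m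
    rw [← h', Finset.sum_mul]
    exact Finset.sum_congr rfl fun i _ => by ring
  rw [Finset.sum_congr rfl fun m _ => this m]
  simp

/-- At a point where the Christoffel symbols vanish the metric is stationary. -/
lemma pderiv_metric_eq_zero (hG : ∀ x i j, G x i j = G x j i) {x : V n} (hdet : (G x).det ≠ 0)
    (h : ∀ i j k, christoffel G i j k x = 0) (a b c : Fin n) :
    pderiv a (fun z => G z b c) x = 0 := by
  -- Metric compatibility: the lowered symbols satisfy `Γ_{c,ab} + Γ_{b,ac} = ∂ₐ g_{bc}`.
  have h1 := sum_mul_christoffel hdet c a b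
  have h2 := sum_mul_christoffel hdet b a c
  simp only [h, mul_zero, Finset.sum_const_zero] at h1 h2
  have e1 : (fun z => G z c b) = fun z => G z b c := funext fun z => hG z c b
  rw [e1] at h2
  linarith

end Coefficients

/-! ### Smoothness and nondegeneracy of a pulled-back metric. -/

section Pullback

variable {n : ℕ} {M : Type*} [TopologicalSpace M] [ChartedSpace (V n) M] [IsManifold (𝓡 n) ∞ M]

lemma pullbackMetric_symm (g : Metric n M) (F : V n → M) (x : V n) (i j : Fin n) :
    pullbackMetric g F x i j = pullbackMetric g F x j i :=
  g.symm _ _ _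

lemma pullbackMetric_congr (g : Metric n M) {F F' : V n → M} {x : V n} (h : F =ᶠ[𝓝 x] F') :
    pullbackMetric g F =ᶠ[𝓝 x] pullbackMetric g F' := by
  filter_upwards [h.eventuallyEq_nhds] with z hz
  ext i j
  have h1 := hz.eq_of_nhds
  have h2 := hz.mfderiv_eq (I := 𝓡 n) (I' := 𝓡 n)
  simp only [pullbackMetric, h2]
  congr!

/-- The coefficient is the smooth section `g` evaluated on the fields `dF(∂ᵢ)`, `dF(∂ⱼ)`, which are
smooth because the tangent map of `F` is. -/
lemma contDiffAt_pullbackMetric (g : Metric n M) {F : V n → M} {U : Set (V n)} (hU : IsOpen U)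
    (hF : ContMDiffOn (𝓡 n) (𝓡 n) ∞ F U) {x : V n} (hx : x ∈ U) (i j : Fin n) :
    ContDiffAt ℝ ∞ (fun z => pullbackMetric g F z i j) x := by
  have hT : ContMDiffOn (𝓡 n).tangent (𝓡 n).tangent ∞ (tangentMapWithin (𝓡 n) (𝓡 n) F U)
      (Bundle.TotalSpace.proj ⁻¹' U) :=
    hF.contMDiffOn_tangentMapWithin (by simp) hU.uniqueMDiffOn
  have hsec (a : Fin n) : ContMDiffAt (𝓡 n) (𝓡 n).tangent ∞
      (fun z : V n => (⟨z, basisVec a⟩ : TangentBundle (𝓡 n) (V n))) x :=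
    contMDiffAt_vectorSpace_iff_contDiffAt.2 contDiffAt_const
  have hv (a : Fin n) : ContMDiffAt (𝓡 n) (𝓡 n).tangent ∞
      (fun z => (⟨F z, mfderiv (𝓡 n) (𝓡 n) F z (basisVec a)⟩ : TangentBundle (𝓡 n) M)) x := by
    have h1 : ContMDiffAt (𝓡 n).tangent (𝓡 n).tangent ∞ (tangentMapWithin (𝓡 n) (𝓡 n) F U)
        (⟨x, basisVec a⟩ : TangentBundle (𝓡 n) (V n)) :=
      hT.contMDiffAt ((hU.preimage (FiberBundle.continuous_proj _ _)).mem_nhds hx)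
    refine (ContMDiffAt.comp x h1 (hsec a)).congr_of_eventuallyEq ?_
    filter_upwards [hU.mem_nhds hx] with z hz
    simp [tangentMapWithin, mfderivWithin_of_isOpen hU hz]
  have : ContMDiffAt (𝓡 n) ((𝓡 n).prod 𝓘(ℝ)) ∞
      (fun z ↦ Bundle.TotalSpace.mk' ℝ (E := Bundle.Trivial M ℝ) (F z)
        (g.inner (F z) (mfderiv (𝓡 n) (𝓡 n) F z (basisVec i))
          (mfderiv (𝓡 n) (𝓡 n) F z (basisVec j)))) x := by
    apply ContMDiffAt.clm_bundle_apply₂ (F₁ := V n) (F₂ := V n)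
    · exact (g.contMDiff.contMDiffAt).comp x (hF.contMDiffAt (hU.mem_nhds hx))
    · exact hv i
    · exact hv j
  simp only [Bundle.contMDiffAt_totalSpace] at this
  exact contMDiffAt_iff_contDiffAt.1 this.2

lemma sum_smul_basisVec (c : Fin n → ℝ) : ∑ i, c i • basisVec i = WithLp.toLp 2 c := by
  ext j
  simp [basisVec, Pi.single_apply]

/-- A null vector `c` of this Gram matrix would make `∑ cᵢ dF(∂ᵢ)`, nonzero by injectivity, a vector
of length zero. -/
lemma det_pullbackMetric_ne_zero (g : Metric n M) {F : V n → M} {x : V n}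
    (hF : Function.Injective (mfderiv (𝓡 n) (𝓡 n) F x)) : (pullbackMetric g F x).det ≠ 0 := by
  intro h
  obtain ⟨c, hc, hc0⟩ := Matrix.exists_mulVec_eq_zero_iff.2 h
  set L : TangentSpace (𝓡 n) x →L[ℝ] TangentSpace (𝓡 n) (F x) := mfderiv (𝓡 n) (𝓡 n) F x with hL
  let b : Fin n → TangentSpace (𝓡 n) x := fun i => basisVec i
  have hw : ∑ i, c i • L (b i) ≠ 0 := by
    intro h0
    have h1 : L (∑ i, c i • b i) = L 0 := by
      rw [map_sum, map_zero, ← h0]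
      exact Finset.sum_congr rfl fun i _ => map_smul _ _ _
    have h2 : (∑ i, c i • basisVec i : V n) = 0 := hF h1
    rw [sum_smul_basisVec] at h2
    exact hc (by simpa using congrArg WithLp.ofLp h2)
  have hz : g.inner (F x) (∑ i, c i • L (b i)) (∑ i, c i • L (b i)) =
      ∑ i, c i * ((pullbackMetric g F x).mulVec c) i := by
    rw [map_sum]
    refine Finset.sum_congr rfl fun i _ => ?_
    rw [map_smul, smul_eq_mul, g.symm, map_sum, Matrix.mulVec, dotProduct]
    congr 1
    refine Finset.sum_congr rfl fun j _ => ?_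
    rw [map_smul, smul_eq_mul, mul_comm]
    rfl
  have hpos := g.pos _ _ hw
  rw [hz, hc0] at hpos
  simp at hpos

end Pullback

/-! ### Uniqueness and rescaling of geodesics, and the exponential map along rays. -/

section Geodesics

variable {n : ℕ} {M : Type*} [TopologicalSpace M] [ChartedSpace (V n) M]
  {χ : OpenPartialHomeomorph M (V n)}

lemma chart_mdifferentiable (hχ : χ ∈ IsManifold.maximalAtlas (𝓡 n) ∞ M) :
    χ.MDifferentiable (𝓡 n) (𝓡 n) :=
  ⟨(contMDiffOn_of_mem_maximalAtlas hχ).mdifferentiableOn (by simp),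
    (contMDiffOn_symm_of_mem_maximalAtlas hχ).mdifferentiableOn (by simp)⟩

lemma contDiffAt_chart_comp (hχ : χ ∈ IsManifold.maximalAtlas (𝓡 n) ∞ M) {c : ℝ → M}
    (hc : ContMDiff 𝓘(ℝ, ℝ) (𝓡 n) ∞ c) {t : ℝ} (ht : c t ∈ χ.source) :
    ContDiffAt ℝ ∞ (fun s => χ (c s)) t :=
  contMDiffAt_iff_contDiffAt.1
    ((contMDiffAt_of_mem_maximalAtlas hχ ht).comp t hc.contMDiffAt)

lemma deriv_chart_comp (hχ : χ ∈ IsManifold.maximalAtlas (𝓡 n) ∞ M) {c : ℝ → M} {t : ℝ}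
    (hc : MDifferentiableAt 𝓘(ℝ, ℝ) (𝓡 n) c t) (ht : c t ∈ χ.source) :
    deriv (fun s => χ (c s)) t = mfderiv (𝓡 n) (𝓡 n) χ (c t) (velocity c t) := by
  have h := mfderiv_comp t ((chart_mdifferentiable hχ).mdifferentiableAt ht) hc
  rw [mfderiv_eq_fderiv] at h
  have h' := DFunLike.congr_fun h (1 : ℝ)
  exact h'

lemma velocity_comp_mul {c : ℝ → M} {a t : ℝ} (hc : MDifferentiableAt 𝓘(ℝ, ℝ) (𝓡 n) c (a * t)) :
    velocity (fun s => c (a * s)) t = a • velocity (n := n) c (a * t) := by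
  have hd : HasMFDerivAt 𝓘(ℝ, ℝ) 𝓘(ℝ, ℝ) (fun s : ℝ => a * s) t
      (ContinuousLinearMap.toSpanSingleton ℝ a) :=
    ((hasDerivAt_id t).const_mul a |>.congr_deriv (mul_one a)).hasFDerivAt.hasMFDerivAt
  have h := (hc.hasMFDerivAt.comp t hd).mfderiv
  have h1 : velocity (fun s => c (a * s)) t =
      mfderiv 𝓘(ℝ, ℝ) (𝓡 n) c (a * t) (ContinuousLinearMap.toSpanSingleton ℝ a (1 : ℝ)) :=
    DFunLike.congr_fun h (1 : ℝ)
  let L : ℝ →L[ℝ] V n := mfderiv 𝓘(ℝ, ℝ) (𝓡 n) c (a * t)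
  have h2 : ContinuousLinearMap.toSpanSingleton ℝ a (1 : ℝ) = a • (1 : ℝ) := by simp
  exact h1.trans ((congrArg L h2).trans (map_smul L a 1))

variable [IsManifold (𝓡 n) ∞ M] {g : Metric n M}

lemma contDiffAt_chart_christoffel (g : Metric n M)
    (hχ : χ ∈ IsManifold.maximalAtlas (𝓡 n) ∞ M) {x : V n} (hx : x ∈ χ.target) (i j k : Fin n) :
    ContDiffAt ℝ ∞ (christoffel (pullbackMetric g χ.symm) i j k) x :=
  contDiffAt_christoffel
    (contDiffAt_pullbackMetric g χ.open_target (contMDiffOn_symm_of_mem_maximalAtlas hχ) hx)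
    (det_pullbackMetric_ne_zero g ((chart_mdifferentiable hχ).symm.mfderiv_injective hx)) i j k

lemma deriv_apply {x : ℝ → V n} {t : ℝ} (hx : DifferentiableAt ℝ x t) (i : Fin n) :
    deriv (fun s => x s i) t = deriv x t i :=
  (((EuclideanSpace.proj (𝕜 := ℝ) i).hasFDerivAt.comp_hasDerivAt t hx.hasDerivAt)).deriv

/-- The vector field of the geodesic flow in coordinates. -/
noncomputable def geodesicField (Γ : Fin n → Fin n → Fin n → V n → ℝ) (z : V n × V n) :
    V n × V n :=
  (z.2, WithLp.toLp 2 fun i => -∑ j, ∑ k, Γ i j k z.1 * z.2 j * z.2 k)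

lemma contDiffAt_geodesicField {Γ : Fin n → Fin n → Fin n → V n → ℝ} {z : V n × V n}
    (hΓ : ∀ i j k, ContDiffAt ℝ ∞ (Γ i j k) z.1) : ContDiffAt ℝ ∞ (geodesicField Γ) z := by
  have hp (j : Fin n) : ContDiffAt ℝ ∞ (fun w : V n × V n => w.2 j) z :=
    (EuclideanSpace.proj (𝕜 := ℝ) j).contDiff.contDiffAt.comp z contDiffAt_snd
  refine contDiffAt_snd.prodMk (contDiffAt_euclidean.2 fun i => ?_)
  refine ContDiffAt.neg (ContDiffAt.sum fun j _ => ContDiffAt.sum fun k _ => ?_)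
  exact (((hΓ i j k).comp z contDiffAt_fst).mul (hp j)).mul (hp k)

/-- The geodesic equation as a first-order autonomous system for position and velocity, the form
needed for ODE uniqueness. -/
lemma IsGeodesic.hasDerivAt_phase {c : ℝ → M} (hc : IsGeodesic g c)
    (hχ : χ ∈ IsManifold.maximalAtlas (𝓡 n) ∞ M) {t : ℝ} (ht : c t ∈ χ.source) :
    HasDerivAt (fun s => (χ (c s), deriv (fun r => χ (c r)) s))
      (geodesicField (christoffel (pullbackMetric g χ.symm))
        (χ (c t), deriv (fun r => χ (c r)) t)) t := by
  have hx := contDiffAt_chart_comp hχ hc.1 ht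
  have hx' : DifferentiableAt ℝ (deriv fun r => χ (c r)) t :=
    ((hx.fderiv_right (m := ∞) (by simp)).clm_apply contDiffAt_const).differentiableAt (by simp)
  refine (hx.differentiableAt (by simp)).hasDerivAt.prodMk ?_
  convert hx'.hasDerivAt using 1
  have hev : ∀ᶠ s in 𝓝 t, c s ∈ χ.source :=
    hc.1.continuous.continuousAt.eventually_mem (χ.open_source.mem_nhds ht)
  have hcomp {s : ℝ} (hs : c s ∈ χ.source) (j : Fin n) :
      deriv (fun r => χ (c r) j) s = deriv (fun r => χ (c r)) s j :=
    deriv_apply ((contDiffAt_chart_comp hχ hc.1 hs).differentiableAt (by simp)) j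
  ext i
  have h := hc.2 χ hχ t ht i
  have h2 : deriv (deriv fun r => χ (c r) i) t = deriv (deriv fun r => χ (c r)) t i := by
    rw [← deriv_apply hx']
    exact EventuallyEq.deriv_eq (hev.mono fun s hs => hcomp hs i)
  simp only [h2, hcomp ht] at h
  exact (eq_neg_of_add_eq_zero_left h).symm

/-- The geodesic field is `C¹`, hence locally Lipschitz, so ODE uniqueness applies inside one chart.
-/
lemma IsGeodesic.eventuallyEq {c₁ c₂ : ℝ → M} (h₁ : IsGeodesic g c₁) (h₂ : IsGeodesic g c₂)
    (hχ : χ ∈ IsManifold.maximalAtlas (𝓡 n) ∞ M) {t : ℝ} (ht : c₁ t ∈ χ.source)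
    (hpt : c₁ t = c₂ t) (hv : deriv (fun s => χ (c₁ s)) t = deriv (fun s => χ (c₂ s)) t) :
    c₁ =ᶠ[𝓝 t] c₂ := by
  have ht₂ : c₂ t ∈ χ.source := hpt ▸ ht
  have hf : ContDiffAt ℝ 1 (geodesicField (christoffel (pullbackMetric g χ.symm)))
      (χ (c₁ t), deriv (fun r => χ (c₁ r)) t) :=
    (contDiffAt_geodesicField fun i j k =>
      contDiffAt_chart_christoffel g hχ (χ.map_source ht) i j k).of_le (by simp)
  obtain ⟨K, s, hs, hK⟩ := hf.exists_lipschitzOnWith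
  have key (c : ℝ → M) (hc : IsGeodesic g c) (hct : c t ∈ χ.source)
      (hs' : s ∈ 𝓝 (χ (c t), deriv (fun r => χ (c r)) t)) : ∀ᶠ r in 𝓝 t,
      HasDerivAt (fun s => (χ (c s), deriv (fun r => χ (c r)) s))
        (geodesicField (christoffel (pullbackMetric g χ.symm))
          (χ (c r), deriv (fun r => χ (c r)) r)) r ∧ (χ (c r), deriv (fun r => χ (c r)) r) ∈ s := by
    filter_upwards [hc.1.continuous.continuousAt.eventually_mem (χ.open_source.mem_nhds hct),
      (hc.hasDerivAt_phase hχ hct).continuousAt.eventually_mem hs'] with r hr hr'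
    exact ⟨hc.hasDerivAt_phase hχ hr, hr'⟩
  have := ODE_solution_unique_of_eventually
    (v := fun _ => geodesicField (christoffel (pullbackMetric g χ.symm))) (s := fun _ => s)
    (Eventually.of_forall fun _ => hK) (key c₁ h₁ ht hs)
    (key c₂ h₂ ht₂ (by rw [← hv, ← hpt]; exact hs)) (by rw [hv, hpt])
  filter_upwards [this, h₁.1.continuous.continuousAt.eventually_mem (χ.open_source.mem_nhds ht),
    h₂.1.continuous.continuousAt.eventually_mem (χ.open_source.mem_nhds ht₂)] with r hr hr₁ hr₂
  exact χ.injOn hr₁ hr₂ (congrArg Prod.fst hr)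

/-- A geodesic is determined by its initial point and velocity. -/
theorem IsGeodesicFrom.unique [T2Space M] {w : TangentBundle (𝓡 n) M} {c₁ c₂ : ℝ → M}
    (h₁ : IsGeodesicFrom g w c₁) (h₂ : IsGeodesicFrom g w c₂) : c₁ = c₂ := by
  have hchart (t : ℝ) : chartAt (V n) (c₁ t) ∈ IsManifold.maximalAtlas (𝓡 n) ∞ M :=
    IsManifold.chart_mem_maximalAtlas _
  have hd (c : ℝ → M) (hc : IsGeodesic g c) (t : ℝ) : MDifferentiableAt 𝓘(ℝ, ℝ) (𝓡 n) c t :=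
    hc.1.mdifferentiableAt (by simp)
  have hw := h₁.2.trans h₂.2.symm
  have h0 : c₁ 0 = c₂ 0 := congrArg Bundle.TotalSpace.proj hw
  -- Connectedness argument. Using equality of germs instead of values makes `S` open for free;
  -- closedness follows by passing to the limit in position and in chart velocity.
  set S : Set ℝ := {t | c₁ =ᶠ[𝓝 t] c₂} with hS
  have hopen : IsOpen S := isOpen_setOfPred_eventually_nhds
  have h0S : (0 : ℝ) ∈ S := by
    have hm := mem_chart_source (V n) (c₁ 0)
    refine h₁.1.eventuallyEq h₂.1 (hchart 0) hm h0 ?_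
    rw [deriv_chart_comp (hchart 0) (hd _ h₁.1 0) hm,
      deriv_chart_comp (hchart 0) (hd _ h₂.1 0) (h0 ▸ hm)]
    exact congrArg (fun w : TangentBundle (𝓡 n) M =>
      (mfderiv (𝓡 n) (𝓡 n) (chartAt (V n) (c₁ 0)) w.proj w.2 : V n)) hw
  have hclosed : IsClosed S := by
    refine isClosed_of_closure_subset fun t ht => ?_
    have hpt : c₁ t = c₂ t :=
      closure_minimal (fun s hs => Eventually.self_of_nhds hs)
        (isClosed_eq h₁.1.1.continuous h₂.1.1.continuous) ht
    have hm := mem_chart_source (V n) (c₁ t)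
    refine h₁.1.eventuallyEq h₂.1 (hchart t) hm hpt ?_
    refine tendsto_nhds_unique_of_frequently_eq
      (h₁.1.hasDerivAt_phase (hchart t) hm).continuousAt.snd
      (h₂.1.hasDerivAt_phase (hchart t) (hpt ▸ hm)).continuousAt.snd ?_
    refine (mem_closure_iff_frequently.1 ht).mono fun s hs => ?_
    exact EventuallyEq.deriv_eq (EventuallyEq.fun_comp hs (chartAt (V n) (c₁ t)))
  have huniv := IsClopen.eq_univ ⟨hclosed, hopen⟩ ⟨0, h0S⟩
  funext t
  exact (show t ∈ S from huniv ▸ Set.mem_univ t).self_of_nhds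

/-- Both terms of the geodesic equation scale by `a²`. -/
lemma IsGeodesic.comp_mul {c : ℝ → M} (hc : IsGeodesic g c) (a : ℝ) :
    IsGeodesic g (fun t => c (a * t)) := by
  refine ⟨hc.1.comp ((contDiff_const.mul contDiff_id).contMDiff), fun χ hχ t ht i => ?_⟩
  have h := hc.2 χ hχ (a * t) ht i
  have e (j : Fin n) : deriv (fun s => χ (c (a * s)) j) =
      fun s => a * deriv (fun s => χ (c s) j) (a * s) := by
    funext s
    exact deriv_comp_mul_left a (fun s => χ (c s) j) s
  have e2 : deriv (fun s => a * deriv (fun s => χ (c s) i) (a * s)) t =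
      a * (a * deriv (deriv (fun s => χ (c s) i)) (a * t)) := by
    rw [deriv_const_mul_field]
    congr 1
    exact deriv_comp_mul_left a (deriv fun s => χ (c s) i) t
  rw [e i, e2]
  simp only [e]
  rw [← mul_zero (a * a), ← h, mul_add, Finset.mul_sum]
  congr 1
  · ring
  refine Finset.sum_congr rfl fun j _ => ?_
  rw [Finset.mul_sum]
  exact Finset.sum_congr rfl fun k _ => by ring

/-- The exponential map along a ray runs through the geodesic with that initial velocity. -/
lemma expMap_smul [T2Space M] {p : M} {v : TangentSpace (𝓡 n) p} {c : ℝ → M}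
    (hc : IsGeodesicFrom g ⟨p, v⟩ c) (t : ℝ) : expMap g ⟨p, t • v⟩ = c t := by
  have h : IsGeodesicFrom g ⟨p, t • v⟩ (fun s => c (t * s)) := by
    refine ⟨hc.1.comp_mul t, ?_⟩
    -- The velocity lives over `c (t * 0)`, which is not syntactically `c 0`; a free `r` allows
    -- substitution in the dependent pair.
    have hz (r : ℝ) (hr : r = 0) :
        (⟨c r, t • velocity c r⟩ : TangentBundle (𝓡 n) M) = ⟨p, t • v⟩ := by
      subst hr
      exact congrArg (fun w : TangentBundle (𝓡 n) M =>
        (⟨w.proj, t • w.2⟩ : TangentBundle (𝓡 n) M)) hc.2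
    rw [velocity_comp_mul (hc.1.1.mdifferentiableAt (by simp))]
    exact hz _ (mul_zero t)
  have hex : ∃ c : ℝ → M, IsGeodesicFrom g ⟨p, t • v⟩ c := ⟨_, h⟩
  -- Uniqueness identifies the arbitrarily chosen geodesic with the rescaled one.
  rw [expMap, dif_pos hex, hex.choose_spec.unique h]
  exact congrArg c (mul_one t)

end Geodesics

/-! ### Calculus along the axis `x⃗ = 0`. -/

section Axis

variable {k : ℕ}

@[simp] lemma axisPoint_zero_apply (s : ℝ) : axisPoint (k := k) s 0 = s := by simp [axisPoint]

@[simp] lemma axisPoint_succ_apply (s : ℝ) (m : Fin k) : axisPoint s m.succ = 0 := by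
  simp [axisPoint]

lemma axisPoint_eq_smul (s : ℝ) : axisPoint (k := k) s = (0 : V (k + 1)) + s • basisVec 0 := by
  ext i
  refine Fin.cases ?_ (fun m => ?_) i <;> simp [axisPoint, basisVec]

@[simp] lemma normalPart_axisPoint (s : ℝ) : normalPart (axisPoint (k := k) s) = 0 := by
  ext m
  simp [normalPart]

lemma hasDerivAt_axisPoint (s : ℝ) : HasDerivAt (axisPoint (k := k)) (basisVec 0) s := by
  have h : (axisPoint : ℝ → V (k + 1)) = fun s => (0 : V (k + 1)) + s • basisVec 0 :=
    funext axisPoint_eq_smul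
  rw [h]
  simpa using ((hasDerivAt_id s).smul_const (basisVec (0 : Fin (k + 1)))).const_add 0

lemma hasDerivAt_comp_axisPoint {f : V (k + 1) → ℝ} {s : ℝ}
    (hf : DifferentiableAt ℝ f (axisPoint s)) :
    HasDerivAt (fun t => f (axisPoint t)) (pderiv 0 f (axisPoint s)) s :=
  hf.hasFDerivAt.comp_hasDerivAt s (hasDerivAt_axisPoint s)

lemma pderiv_zero_eq_zero {f : V (k + 1) → ℝ} {s : ℝ} (hf : DifferentiableAt ℝ f (axisPoint s))
    (h : ∀ t, f (axisPoint t) = 0) : pderiv 0 f (axisPoint s) = 0 := by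
  rw [← (hasDerivAt_comp_axisPoint hf).deriv, funext h, deriv_const]

/-- Each further axis derivative differentiates, along the axis, a function already known to vanish
on all of it. This is (a) once `Γ` vanishes on the axis. -/
lemma multiDeriv_zero_eq_zero {f : V (k + 1) → ℝ} (hf : ∀ t, ContDiffAt ℝ ∞ f (axisPoint t))
    (h : ∀ t, f (axisPoint t) = 0) (q : ℕ) (s : ℝ) :
    multiDeriv (fun _ : Fin q => (0 : Fin (k + 1))) f (axisPoint s) = 0 := by
  simp only [axisPoint_eq_smul] at hf h ⊢
  induction q generalizing s with
  | zero => simpa [multiDeriv] using h s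
  | succ q ih =>
    have := ContDiffAt.deriv_fderiv_add_smul (n := q) ((hf s).of_le (by exact_mod_cast le_top))
    rw [multiDeriv, ← this]
    simp only [multiDeriv] at ih
    rw [funext ih, deriv_const]

lemma pderiv_comm {n : ℕ} {f : V n → ℝ} {x : V n} (hf : ContDiffAt ℝ ∞ f x) (i j : Fin n) :
    pderiv i (pderiv j f) x = pderiv j (pderiv i f) x := by
  have hd : DifferentiableAt ℝ (fderiv ℝ f) x :=
    (hf.fderiv_right (m := ∞) (by simp)).differentiableAt (by simp)
  have h (a b : Fin n) : pderiv a (pderiv b f) x =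
      fderiv ℝ (fderiv ℝ f) x (basisVec a) (basisVec b) := by
    have : HasFDerivAt (pderiv b f) ((fderiv ℝ (fderiv ℝ f) x).flip (basisVec b)) x := by
      have h := hd.hasFDerivAt.clm_apply (hasFDerivAt_const (basisVec b) x)
      simp only [ContinuousLinearMap.comp_zero, zero_add] at h
      exact h
    rw [pderiv, this.fderiv]
    rfl
  rw [h, h]
  exact (hf.isSymmSndFDerivAt (by simpa using ENat.LEInfty.out)).eq _ _

lemma pderiv_mul_of_eq_zero {n : ℕ} {f f' : V n → ℝ} {x : V n} (hf : DifferentiableAt ℝ f x)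
    (hf' : DifferentiableAt ℝ f' x) (h : f' x = 0) (i : Fin n) :
    pderiv i (fun z => f z * f' z) x = f x * pderiv i f' x := by
  simp [pderiv, fderiv_fun_mul hf hf', h]

/-- If the Christoffel symbols vanish along the axis and the metric is the standard one there, then
the normal derivatives of `Γ⁰₀₀` vanish along the axis. -/
lemma pderiv_christoffel_zero_zero_zero {G : V (k + 1) → Matrix (Fin (k + 1)) (Fin (k + 1)) ℝ}
    (hG : ∀ s i j, ContDiffAt ℝ ∞ (fun z => G z i j) (axisPoint s))
    (hone : ∀ s, G (axisPoint s) = 1)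
    (hd : ∀ s a b c, pderiv a (fun z => G z b c) (axisPoint s) = 0) (m : Fin (k + 1)) (s : ℝ) :
    pderiv m (christoffel G 0 0 0) (axisPoint s) = 0 := by
  have hdet : (G (axisPoint s)).det ≠ 0 := by simp [hone]
  have hB (l : Fin (k + 1)) : ContDiffAt ℝ ∞ (fun x => pderiv 0 (fun z => G z 0 l) x
      + pderiv 0 (fun z => G z 0 l) x - pderiv l (fun z => G z 0 0) x) (axisPoint s) :=
    ((contDiffAt_pderiv (hG s 0 l) 0).add (contDiffAt_pderiv (hG s 0 l) 0)).sub
      (contDiffAt_pderiv (hG s 0 0) l)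
  have hI (l : Fin (k + 1)) := contDiffAt_matrix_inv (hG s) hdet 0 l
  have hne : (∞ : WithTop ℕ∞) ≠ 0 := by simp
  -- The bracket of first derivatives of `G` vanishes on the axis, so the product rule never
  -- differentiates the inverse metric.
  have h1 : pderiv m (christoffel G 0 0 0) (axisPoint s) = (1 / 2) * ∑ l,
      (G (axisPoint s))⁻¹ 0 l * pderiv m (fun x => pderiv 0 (fun z => G z 0 l) x
      + pderiv 0 (fun z => G z 0 l) x - pderiv l (fun z => G z 0 0) x) (axisPoint s) := by
    unfold christoffel
    rw [pderiv, fderiv_const_mul, fderiv_fun_sum]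
    · simp only [FunLike.coe_smul, FunLike.coe_sum, Pi.smul_apply, Finset.sum_apply, smul_eq_mul]
      congr 1
      refine Finset.sum_congr rfl fun l _ => ?_
      exact pderiv_mul_of_eq_zero ((hI l).differentiableAt hne) ((hB l).differentiableAt hne)
        (by simp [hd]) m
    · exact fun l _ => ((hI l).mul (hB l)).differentiableAt hne
    · exact (ContDiffAt.sum fun l _ => (hI l).mul (hB l)).differentiableAt hne
  rw [h1, hone, inv_one]
  simp only [Matrix.one_apply, ite_mul, one_mul, zero_mul, Finset.sum_ite_eq, Finset.mem_univ,
    if_true, add_sub_cancel_right]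
  -- With the identity metric only `½ ∂ₘ∂₀ g₀₀` is left. After swapping, it is the axis derivative
  -- of `∂ₘ g₀₀`, which is zero along the axis.
  have h2 := pderiv_comm (hG s 0 0) m 0
  rw [show (fun x => pderiv 0 (fun z => G z 0 0) x) = pderiv 0 fun z => G z 0 0 from rfl, h2,
    pderiv_zero_eq_zero ((contDiffAt_pderiv (hG s 0 0) m).differentiableAt hne)
      (fun t => hd t m 0 0), mul_zero]

end Axis

/-! ### Geometry of the Fermi chart: `Γ = 0` and `g = 1` on the axis. -/

section Fermi

variable {k : ℕ} {M : Type*} [TopologicalSpace M] [ChartedSpace (V (k + 1)) M]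

lemma velocity_line {F : V (k + 1) → M} {a b : V (k + 1)} {t : ℝ}
    (hF : MDifferentiableAt (𝓡 (k + 1)) (𝓡 (k + 1)) F (a + t • b)) :
    velocity (fun s => F (a + s • b)) t = mfderiv (𝓡 (k + 1)) (𝓡 (k + 1)) F (a + t • b) b := by
  have hd : HasMFDerivAt 𝓘(ℝ, ℝ) (𝓡 (k + 1)) (fun s : ℝ => a + s • b) t
      (ContinuousLinearMap.toSpanSingleton ℝ b) := by
    have : HasDerivAt (fun s : ℝ => a + s • b) b t := by
      simpa using ((hasDerivAt_id t).smul_const b).const_add a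
    exact this.hasFDerivAt.hasMFDerivAt
  have h := (hF.hasMFDerivAt.comp t hd).mfderiv
  have h1 : velocity (fun s => F (a + s • b)) t =
      mfderiv (𝓡 (k + 1)) (𝓡 (k + 1)) F (a + t • b)
        (ContinuousLinearMap.toSpanSingleton ℝ b (1 : ℝ)) :=
    DFunLike.congr_fun h (1 : ℝ)
  let L : V (k + 1) →L[ℝ] V (k + 1) := mfderiv (𝓡 (k + 1)) (𝓡 (k + 1)) F (a + t • b)
  exact h1.trans (congrArg L (by simp))

variable [IsManifold (𝓡 (k + 1)) ∞ M] {g : Metric (k + 1) M} {γ : ℝ → M}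
  {e : Fin (k + 1) → ∀ t, TangentSpace (𝓡 (k + 1)) (γ t)}

lemma isLocalDiffeomorphAt_normalExp {x : V (k + 1)} (hx : x ∈ fermiDomain g γ e) :
    IsLocalDiffeomorphAt (𝓡 (k + 1)) (𝓡 (k + 1)) ∞ (normalExp g γ e) x := by
  have hx' : ‖normalPart x‖ₑ < focalRadius g γ e := hx
  obtain ⟨r, hr, hxr⟩ := lt_sSup_iff.1 hx'
  exact hr x hxr

/-- Near each point of the Fermi domain the normal exponential map is the inverse of a chart. -/
lemma exists_fermi_chart {x : V (k + 1)} (hx : x ∈ fermiDomain g γ e) :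
    ∃ χ ∈ IsManifold.maximalAtlas (𝓡 (k + 1)) ∞ M, x ∈ χ.target ∧
      Set.EqOn (normalExp g γ e) χ.symm χ.target := by
  obtain ⟨Φ, hxΦ, hΦ⟩ := isLocalDiffeomorphAt_normalExp hx
  exact ⟨Φ.toOpenPartialHomeomorph.symm,
    OpenPartialHomeomorph.mem_maximalAtlas_of_contMDiffOn _ Φ.contMDiffOn_invFun
      Φ.contMDiffOn_toFun, hxΦ, hΦ⟩

variable {χ : OpenPartialHomeomorph M (V (k + 1))}

lemma normalExp_eventuallyEq (hχ : Set.EqOn (normalExp g γ e) χ.symm χ.target) {x : V (k + 1)}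
    (hx : x ∈ χ.target) : normalExp g γ e =ᶠ[𝓝 x] χ.symm :=
  hχ.eventuallyEq_of_mem (χ.open_target.mem_nhds hx)

lemma normalExp_mem_source (hχ : Set.EqOn (normalExp g γ e) χ.symm χ.target) {x : V (k + 1)}
    (hx : x ∈ χ.target) : normalExp g γ e x ∈ χ.source := by
  rw [hχ hx]; exact χ.map_target hx

lemma chart_normalExp (hχ : Set.EqOn (normalExp g γ e) χ.symm χ.target) {x : V (k + 1)}
    (hx : x ∈ χ.target) : χ (normalExp g γ e x) = x := by
  rw [hχ hx]; exact χ.right_inv hx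

/-- Transfers the geodesic and parallel equations, which are formulated in charts, to the Fermi
metric. -/
lemma fermi_christoffel_eq (hχ : Set.EqOn (normalExp g γ e) χ.symm χ.target) {x : V (k + 1)}
    (hx : x ∈ χ.target) (i j l : Fin (k + 1)) : christoffel (fermiMetric g γ e) i j l x =
      christoffel (pullbackMetric g χ.symm) i j l x :=
  christoffel_congr (pullbackMetric_congr g (normalExp_eventuallyEq hχ hx)) i j l

lemma contDiffAt_fermiMetric {x : V (k + 1)} (hx : x ∈ fermiDomain g γ e) (i j : Fin (k + 1)) :
    ContDiffAt ℝ ∞ (fun z => fermiMetric g γ e z i j) x := by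
  obtain ⟨χ, hχ, hxχ, he⟩ := exists_fermi_chart hx
  refine contDiffAt_pullbackMetric g χ.open_target ?_ hxχ i j
  exact (contMDiffOn_symm_of_mem_maximalAtlas hχ).congr he

lemma det_fermiMetric_ne_zero {x : V (k + 1)} (hx : x ∈ fermiDomain g γ e) :
    (fermiMetric g γ e x).det ≠ 0 :=
  det_pullbackMetric_ne_zero g
    ((isLocalDiffeomorphAt_normalExp hx).mfderivToContinuousLinearEquiv (by simp)).injective

lemma contDiffAt_fermi_christoffel {x : V (k + 1)} (hx : x ∈ fermiDomain g γ e)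
    (i j l : Fin (k + 1)) : ContDiffAt ℝ ∞ (christoffel (fermiMetric g γ e) i j l) x :=
  contDiffAt_christoffel (contDiffAt_fermiMetric hx) (det_fermiMetric_ne_zero hx) i j l

/-- A geodesic that is a straight line in Fermi coordinates. -/
lemma IsGeodesic.sum_christoffel_eq_zero {c : ℝ → M} (hc : IsGeodesic g c) {a b : V (k + 1)}
    (h : ∀ t, c t = normalExp g γ e (a + t • b)) {t : ℝ} (ht : a + t • b ∈ fermiDomain g γ e)
    (i : Fin (k + 1)) :
    ∑ j, ∑ l, christoffel (fermiMetric g γ e) i j l (a + t • b) * b j * b l = 0 := by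
  obtain ⟨χ, hχ, hxχ, he⟩ := exists_fermi_chart ht
  have hline : Continuous fun s : ℝ => a + s • b := by fun_prop
  have hev : ∀ᶠ s in 𝓝 t, a + s • b ∈ χ.target :=
    hline.continuousAt.eventually_mem (χ.open_target.mem_nhds hxχ)
  -- The coordinates are affine in time, so the second derivative drops out of the geodesic
  -- equation.
  have hcoord (j : Fin (k + 1)) : (fun s => χ (c s) j) =ᶠ[𝓝 t] fun s => a j + s * b j :=
    hev.mono fun s hs => by simp [h, chart_normalExp he hs]
  have hlin (j : Fin (k + 1)) (s : ℝ) : deriv (fun s => a j + s * b j) s = b j := by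
    simp
  have hd (j : Fin (k + 1)) : deriv (fun s => χ (c s) j) =ᶠ[𝓝 t] fun _ => b j :=
    (hcoord j).deriv.trans (Eventually.of_forall (hlin j))
  have := hc.2 χ hχ t (by rw [h]; exact normalExp_mem_source he hxχ) i
  rw [(hd i).deriv_eq, deriv_const, zero_add] at this
  simp only [(hd _).eq_of_nhds] at this
  rw [h, chart_normalExp he hxχ] at this
  simpa only [fermi_christoffel_eq he hxχ] using this

lemma normalExp_eq {x : V (k + 1)} {s : ℝ} {v : Fin k → ℝ} (h0 : x 0 = s)
    (hv : ∀ m, x m.succ = v m) :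
    normalExp g γ e x = expMap g ⟨γ s, ∑ m, v m • e m.succ s⟩ := by
  subst h0
  simp only [normalExp, hv]

/-- The normal vector with components `v`. -/
noncomputable def normalVec (v : Fin k → ℝ) : V (k + 1) := ∑ m, v m • basisVec m.succ

@[simp] lemma normalVec_zero_apply (v : Fin k → ℝ) : normalVec v 0 = 0 := by
  simp [normalVec, basisVec]

@[simp] lemma normalVec_succ_apply (v : Fin k → ℝ) (m : Fin k) : normalVec v m.succ = v m := by
  simp [normalVec, basisVec, Pi.single_apply]

lemma normalVec_single (m : Fin k) : normalVec (Pi.single m 1) = basisVec m.succ := by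
  simp [normalVec, Pi.single_apply]

/-- Homogeneity of the exponential map: normal geodesics are straight rays in Fermi coordinates. -/
lemma normalExp_ray [T2Space M] {s : ℝ} {v : Fin k → ℝ} {c : ℝ → M}
    (hc : IsGeodesicFrom g ⟨γ s, ∑ m, v m • e m.succ s⟩ c) (t : ℝ) :
    c t = normalExp g γ e (axisPoint s + t • normalVec v) := by
  rw [normalExp_eq (s := s) (v := fun m => t * v m) (by simp) (by simp), ← expMap_smul hc t,
    Finset.smul_sum]
  simp only [smul_smul]

lemma inner_congr {p q : M} {v w : TangentSpace (𝓡 (k + 1)) p} {v' w' : TangentSpace (𝓡 (k + 1)) q}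
    (hv : (⟨p, v⟩ : TangentBundle (𝓡 (k + 1)) M) = ⟨q, v'⟩)
    (hw : (⟨p, w⟩ : TangentBundle (𝓡 (k + 1)) M) = ⟨q, w'⟩) :
    g.inner p v w = g.inner q v' w' := by
  cases hv
  cases hw
  rfl

variable [T2Space M]

lemma normalExp_axisPoint (hg : IsComplete g) (s : ℝ) : normalExp g γ e (axisPoint s) = γ s := by
  obtain ⟨c, hc⟩ := hg ⟨γ s, ∑ m : Fin k, (0 : ℝ) • e m.succ s⟩
  have h := normalExp_ray (v := fun _ => 0) hc 0
  rw [zero_smul, add_zero] at h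
  rw [← h]
  exact congrArg Bundle.TotalSpace.proj hc.2

/-- Both vectors are the initial velocity of the geodesic ray in direction `e m.succ s`. Equality is
taken in the tangent bundle because the base points agree only propositionally. -/
lemma mfderiv_normalExp_succ (hg : IsComplete g) {s : ℝ} (hs : axisPoint s ∈ fermiDomain g γ e)
    (m : Fin k) :
    (⟨normalExp g γ e (axisPoint s), mfderiv (𝓡 (k + 1)) (𝓡 (k + 1)) (normalExp g γ e)
      (axisPoint s) (basisVec m.succ)⟩ : TangentBundle (𝓡 (k + 1)) M) = ⟨γ s, e m.succ s⟩ := by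
  obtain ⟨c, hc⟩ := hg ⟨γ s, ∑ a, (Pi.single m 1 : Fin k → ℝ) a • e a.succ s⟩
  have hcF := funext (normalExp_ray hc)
  have h2 := hc.2
  have hsum : ∑ a, (Pi.single m 1 : Fin k → ℝ) a • e a.succ s = e m.succ s := by
    rw [Finset.sum_eq_single m] <;> simp +contextual
  rw [hsum] at h2
  rw [← h2]
  subst hcF
  have hz : axisPoint s + (0 : ℝ) • normalVec (Pi.single m 1) = axisPoint s := by simp
  have hd : MDifferentiableAt (𝓡 (k + 1)) (𝓡 (k + 1)) (normalExp g γ e)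
      (axisPoint s + (0 : ℝ) • normalVec (Pi.single m 1)) := by
    rw [hz]
    exact (isLocalDiffeomorphAt_normalExp hs).mdifferentiableAt (by simp)
  rw [velocity_line hd, normalVec_single]
  have hcongr (z : V (k + 1)) (hz : z = axisPoint s) :
      (⟨normalExp g γ e (axisPoint s), mfderiv (𝓡 (k + 1)) (𝓡 (k + 1)) (normalExp g γ e)
        (axisPoint s) (basisVec m.succ)⟩ : TangentBundle (𝓡 (k + 1)) M) =
      ⟨normalExp g γ e z, mfderiv (𝓡 (k + 1)) (𝓡 (k + 1)) (normalExp g γ e) z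
        (basisVec m.succ)⟩ := by
    rw [hz]
  exact hcongr _ (by simp)

lemma mfderiv_normalExp_zero (hg : IsComplete g) {s : ℝ} (hs : axisPoint s ∈ fermiDomain g γ e) :
    (⟨normalExp g γ e (axisPoint s), mfderiv (𝓡 (k + 1)) (𝓡 (k + 1)) (normalExp g γ e)
      (axisPoint s) (basisVec 0)⟩ : TangentBundle (𝓡 (k + 1)) M) = ⟨γ s, velocity γ s⟩ := by
  have hγ : γ = fun t => normalExp g γ e ((0 : V (k + 1)) + t • basisVec 0) :=
    funext fun t => by rw [← axisPoint_eq_smul, normalExp_axisPoint hg]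
  have hd := (isLocalDiffeomorphAt_normalExp hs).mdifferentiableAt (by simp)
  rw [axisPoint_eq_smul] at hd ⊢
  rw [← velocity_line hd]
  exact congrArg (fun c : ℝ → M => (⟨c s, velocity c s⟩ : TangentBundle (𝓡 (k + 1)) M)) hγ.symm

/-- The differentials of `χ` and of `normalExp` compose to the identity, and the latter sends
`basisVec m.succ` to the frame vector. -/
lemma chartComponents_frame (hg : IsComplete g) (hχ : χ ∈ IsManifold.maximalAtlas (𝓡 (k + 1)) ∞ M)
    (hF : Set.EqOn (normalExp g γ e) χ.symm χ.target) {s : ℝ}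
    (hs : axisPoint s ∈ fermiDomain g γ e) (hsχ : axisPoint s ∈ χ.target) (m : Fin k) :
    chartComponents χ γ (e m.succ) s = basisVec m.succ := by
  have h1 : chartComponents χ γ (e m.succ) s = mfderiv (𝓡 (k + 1)) (𝓡 (k + 1)) χ
      (normalExp g γ e (axisPoint s)) (mfderiv (𝓡 (k + 1)) (𝓡 (k + 1)) (normalExp g γ e)
      (axisPoint s) (basisVec m.succ)) :=
    congrArg (fun w : TangentBundle (𝓡 (k + 1)) M =>
      (mfderiv (𝓡 (k + 1)) (𝓡 (k + 1)) χ w.proj w.2 : V (k + 1)))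
      (mfderiv_normalExp_succ hg hs m).symm
  have h2 := mfderiv_comp (axisPoint s)
    ((chart_mdifferentiable hχ).mdifferentiableAt (normalExp_mem_source hF hsχ))
    ((isLocalDiffeomorphAt_normalExp hs).mdifferentiableAt (by simp))
  have h3 : χ ∘ normalExp g γ e =ᶠ[𝓝 (axisPoint s)] id := by
    filter_upwards [χ.open_target.mem_nhds hsχ] with z hz using chart_normalExp hF hz
  rw [h3.mfderiv_eq, mfderiv_id] at h2
  exact h1.trans (DFunLike.congr_fun h2 (basisVec m.succ)).symm

/-- Polarization, tested on coordinate vectors and sums of two of them. -/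
lemma symm_eq_zero_of_quadratic_eq_zero {B : Fin k → Fin k → ℝ} (hB : ∀ a b, B a b = B b a)
    (h : ∀ v : Fin k → ℝ, ∑ a, ∑ b, B a b * v a * v b = 0) (a b : Fin k) : B a b = 0 := by
  have h1 (a : Fin k) : B a a = 0 := by simpa [Pi.single_apply] using h (Pi.single a 1)
  have h2 := h (Pi.single a 1 + Pi.single b 1)
  simp [Pi.single_apply, mul_add, Finset.sum_add_distrib, h1, hB b a] at h2
  linarith

theorem fermi_christoffel_axisPoint (hg : IsComplete g) (hγ : IsGeodesic g γ)
    (he : IsFermiFrame g γ e) (hD : ∀ s, axisPoint s ∈ fermiDomain g γ e) (s : ℝ)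
    (i j l : Fin (k + 1)) : christoffel (fermiMetric g γ e) i j l (axisPoint s) = 0 := by
  have hsymm (j l : Fin (k + 1)) : christoffel (fermiMetric g γ e) i j l (axisPoint s) =
      christoffel (fermiMetric g γ e) i l j (axisPoint s) :=
    congrFun (christoffel_symm (pullbackMetric_symm g _) i j l) _
  -- `γ` itself is the coordinate line with direction `basisVec 0`.
  have h00 : christoffel (fermiMetric g γ e) i 0 0 (axisPoint s) = 0 := by
    have h := hγ.sum_christoffel_eq_zero (g := g) (γ := γ) (e := e) (a := 0) (b := basisVec 0)
      (t := s) (fun t => by rw [← axisPoint_eq_smul, normalExp_axisPoint hg])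
      (by rw [← axisPoint_eq_smul]; exact hD s) i
    rw [← axisPoint_eq_smul] at h
    simpa [basisVec, Pi.single_apply] using h
  have hnn (a b : Fin k) :
      christoffel (fermiMetric g γ e) i a.succ b.succ (axisPoint s) = 0 := by
    refine symm_eq_zero_of_quadratic_eq_zero
      (B := fun a b => christoffel (fermiMetric g γ e) i a.succ b.succ (axisPoint s))
      (fun a b => hsymm _ _) (fun v => ?_) a b
    -- The geodesic with this normal velocity is a ray; its equation at time `0` is the quadratic
    -- identity in `v`.
    obtain ⟨c, hc⟩ := hg ⟨γ s, ∑ m, v m • e m.succ s⟩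
    have h := hc.1.sum_christoffel_eq_zero (t := 0) (normalExp_ray hc) (by simpa using hD s) i
    simpa [Fin.sum_univ_succ] using h
  have h0n (m : Fin k) : christoffel (fermiMetric g γ e) i 0 m.succ (axisPoint s) = 0 := by
    obtain ⟨χ, hχ, hxχ, hF⟩ := exists_fermi_chart (hD s)
    have hev : ∀ᶠ t in 𝓝 s, axisPoint t ∈ χ.target :=
      (hasDerivAt_axisPoint s).continuousAt.eventually_mem (χ.open_target.mem_nhds hxχ)
    have hpar := he.parallel m.succ χ hχ s
      (by rw [← normalExp_axisPoint (e := e) hg s]; exact normalExp_mem_source hF hxχ) i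
    have hconst : (fun t => chartComponents χ γ (e m.succ) t i) =ᶠ[𝓝 s]
        fun _ => basisVec m.succ i :=
      hev.mono fun t ht => by simp only [chartComponents_frame hg hχ hF (hD t) ht]
    have hcoord (j : Fin (k + 1)) :
        (fun t => χ (γ t) j) =ᶠ[𝓝 s] fun t => axisPoint (k := k) t j :=
      hev.mono fun t ht => by
        simp only
        rw [← normalExp_axisPoint (e := e) hg t, chart_normalExp hF ht]
    have hd (j : Fin (k + 1)) : deriv (fun t => χ (γ t) j) s = (basisVec 0 : V (k + 1)) j := by
      rw [(hcoord j).deriv_eq, deriv_apply (hasDerivAt_axisPoint s).differentiableAt,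
        (hasDerivAt_axisPoint s).deriv]
    -- The component is constant, so its derivative, prescribed by parallel transport, is zero; only
    -- the term `Γⁱ₀ₘ` remains in it.
    have hzero := hpar.unique ((hasDerivAt_const s _).congr_of_eventuallyEq hconst)
    have hpt : χ (γ s) = axisPoint s := by
      rw [← normalExp_axisPoint (e := e) hg s, chart_normalExp hF hxχ]
    rw [chartComponents_frame hg hχ hF (hD s) hxχ] at hzero
    simp only [hd, hpt, ← fermi_christoffel_eq hF hxχ] at hzero
    simpa [basisVec, Pi.single_apply] using hzero
  refine Fin.cases ?_ (fun a => ?_) j <;> refine Fin.cases ?_ (fun b => ?_) l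
  · exact h00
  · exact h0n b
  · rw [hsymm]; exact h0n a
  · exact hnn a b

/-- Vanishing symbols make the metric constant along the axis, and at `s = 0` it is the Gram matrix
of the orthonormal frame. -/
theorem fermiMetric_axisPoint (hg : IsComplete g) (hγ : IsGeodesic g γ)
    (he : IsFermiFrame g γ e) (hD : ∀ s, axisPoint s ∈ fermiDomain g γ e) (s : ℝ) :
    fermiMetric g γ e (axisPoint s) = 1 := by
  have hframe (i : Fin (k + 1)) :
      (⟨normalExp g γ e (axisPoint 0), mfderiv (𝓡 (k + 1)) (𝓡 (k + 1)) (normalExp g γ e)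
        (axisPoint 0) (basisVec i)⟩ : TangentBundle (𝓡 (k + 1)) M) = ⟨γ 0, e i 0⟩ := by
    refine Fin.cases ?_ (fun m => ?_) i
    · rw [mfderiv_normalExp_zero hg (hD 0), he.first]
    · exact mfderiv_normalExp_succ hg (hD 0) m
  ext i j
  have hdiff (t : ℝ) : HasDerivAt (fun r => fermiMetric g γ e (axisPoint r) i j) 0 t := by
    have h := hasDerivAt_comp_axisPoint (f := fun z => fermiMetric g γ e z i j) (s := t)
      ((contDiffAt_fermiMetric (hD t) i j).differentiableAt (by simp))
    rwa [pderiv_metric_eq_zero (G := fermiMetric g γ e) (pullbackMetric_symm g _)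
      (det_fermiMetric_ne_zero (hD t))
      (fermi_christoffel_axisPoint hg hγ he hD t)] at h
  have hconst := is_const_of_deriv_eq_zero (fun t => (hdiff t).differentiableAt)
    (fun t => (hdiff t).deriv) s 0
  rw [hconst, Matrix.one_apply, ← he.orthonormal i j]
  exact inner_congr (hframe i) (hframe j)

end Fermi

/-! ### Taylor expansion about the axis, with integral remainder. -/

section Taylor

variable {k : ℕ}

/-- The Taylor term of order `q` of `F` at `(s, 0⃗)`. -/
noncomputable def taylorTerm (q : ℕ) (F : V (k + 1) → ℝ) (s : ℝ) (u : V (k + 1)) : ℝ :=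
  ∑ A : Fin q → Fin (k + 1),
    ((q.factorial : ℝ))⁻¹ * multiDeriv A F (axisPoint s) * ∏ a, u (A a)

/-- The Taylor remainder of order `N` of `F` at `(s, 0⃗)`. -/
noncomputable def taylorRemainder (N : ℕ) (F : V (k + 1) → ℝ) (s : ℝ) (u : V (k + 1)) : ℝ :=
  F (axisPoint s + u) - ∑ q ∈ Finset.range (N + 1), taylorTerm q F s u

lemma iteratedFDeriv_diag {n q : ℕ} (F : V n → ℝ) (x u : V n) :
    iteratedFDeriv ℝ q F x (fun _ => u) =
      ∑ A : Fin q → Fin n, multiDeriv A F x * ∏ a, u (A a) := by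
  have hu : u = ∑ i, u i • basisVec i := by rw [sum_smul_basisVec]
  conv_lhs => rw [hu]
  rw [ContinuousMultilinearMap.map_sum]
  refine Finset.sum_congr rfl fun A _ => ?_
  rw [ContinuousMultilinearMap.map_smul_univ, smul_eq_mul, mul_comm]
  rfl

lemma taylorTerm_eq (q : ℕ) (F : V (k + 1) → ℝ) (s : ℝ) (u : V (k + 1)) :
    taylorTerm q F s u =
      ((q.factorial : ℝ))⁻¹ * iteratedFDeriv ℝ q F (axisPoint s) (fun _ => u) := by
  simp only [taylorTerm, iteratedFDeriv_diag, Finset.mul_sum, mul_assoc]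

lemma abs_iteratedFDeriv_diag_le {n q : ℕ} {F : V n → ℝ} {x : V n} {K : ℝ}
    (hK : ∀ A : Fin q → Fin n, |multiDeriv A F x| ≤ K) (u : V n) :
    |iteratedFDeriv ℝ q F x (fun _ => u)| ≤ (n : ℝ) ^ q * K * ‖u‖ ^ q := by
  rw [iteratedFDeriv_diag]
  refine (Finset.abs_sum_le_sum_abs _ _).trans ?_
  have : ∀ A : Fin q → Fin n, |multiDeriv A F x * ∏ a, u (A a)| ≤ K * ‖u‖ ^ q := by
    intro A
    rw [abs_mul, Finset.abs_prod]
    have h1 : ∏ a, |u (A a)| ≤ ‖u‖ ^ q := by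
      refine (Finset.prod_le_prod (fun _ _ => abs_nonneg _)
        fun a _ => PiLp.norm_apply_le u (A a)).trans ?_
      simp
    exact mul_le_mul (hK A) h1 (Finset.prod_nonneg fun _ _ => abs_nonneg _)
      ((abs_nonneg _).trans (hK A))
  refine (Finset.sum_le_card_nsmul _ _ _ fun A _ => this A).trans ?_
  simp [mul_assoc]

lemma abs_taylorRemainder_le {N : ℕ} {F : V (k + 1) → ℝ} {s K : ℝ} {u : V (k + 1)}
    (hF : ∀ t ∈ Set.Icc (0 : ℝ) 1, ContDiffAt ℝ ∞ F (axisPoint s + t • u))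
    (hK : ∀ t ∈ Set.Icc (0 : ℝ) 1, ∀ A : Fin (N + 1) → Fin (k + 1),
      |multiDeriv A F (axisPoint s + t • u)| ≤ K) :
    |taylorRemainder N F s u| ≤ ((k + 1 : ℕ) : ℝ) ^ (N + 1) * K * ‖u‖ ^ (N + 1) := by
  have h := map_add_eq_sum_add_integral_iteratedFDeriv (n := N) (f := F) (x := axisPoint s) (y := u)
    fun t ht => (hF t ht).of_le (by exact_mod_cast le_top)
  have hrem : taylorRemainder N F s u = ((N.factorial : ℝ))⁻¹ • ∫ t in (0 : ℝ)..1, (1 - t) ^ N •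
      iteratedFDeriv ℝ (N + 1) F (axisPoint s + t • u) (fun _ => u) := by
    simp only [taylorRemainder, taylorTerm_eq]
    rw [h]
    simp only [smul_eq_mul]
    ring
  have hbound : ‖∫ t in (0 : ℝ)..1, (1 - t) ^ N •
      iteratedFDeriv ℝ (N + 1) F (axisPoint s + t • u) (fun _ => u)‖ ≤
      ((k + 1 : ℕ) : ℝ) ^ (N + 1) * K * ‖u‖ ^ (N + 1) * |1 - 0| := by
    refine intervalIntegral.norm_integral_le_of_norm_le_const fun t ht => ?_
    rw [Set.uIoc_of_le zero_le_one] at ht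
    have hb := abs_iteratedFDeriv_diag_le (hK t ⟨ht.1.le, ht.2⟩) u
    rw [norm_smul, Real.norm_eq_abs, Real.norm_eq_abs, abs_pow]
    have h1 : |1 - t| ^ N ≤ 1 :=
      pow_le_one₀ (abs_nonneg _) (abs_le.2 ⟨by linarith [ht.2], by linarith [ht.1]⟩)
    calc _ ≤ 1 * |iteratedFDeriv ℝ (N + 1) F (axisPoint s + t • u) fun _ => u| := by gcongr
      _ ≤ _ := by rw [one_mul]; exact hb
  rw [hrem, abs_smul, abs_of_nonneg (by positivity), smul_eq_mul]
  rw [sub_zero, abs_one, mul_one, Real.norm_eq_abs] at hbound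
  -- The factor `1 / N!` of the remainder is simply estimated by `1`.
  refine (mul_le_of_le_one_left (abs_nonneg _) ?_).trans hbound
  exact inv_le_one_of_one_le₀ (by exact_mod_cast N.factorial_pos)

variable {F : V (k + 1) → ℝ}

/-- The only omitted multi-index is the pure axis one, whose derivative vanishes. -/
lemma taylorTerm_eq_mixedTaylor (hF : ∀ t, ContDiffAt ℝ ∞ F (axisPoint t))
    (h0 : ∀ t, F (axisPoint t) = 0) (s : ℝ) (u : V (k + 1)) (q : ℕ) :
    taylorTerm q F s u = mixedTaylor q F s u := by
  rw [taylorTerm, mixedTaylor, ← Finset.sum_filter_add_sum_filter_not Finset.univ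
    (fun A : Fin q → Fin (k + 1) => A ≠ fun _ => 0)]
  refine add_eq_left.2 (Finset.sum_eq_zero fun A hA => ?_)
  have hA' : A = fun _ => 0 := by simpa using hA
  rw [hA', multiDeriv_zero_eq_zero hF h0, mul_zero, zero_mul]

lemma taylorTerm_one (hF : ∀ t, ContDiffAt ℝ ∞ F (axisPoint t))
    (h0 : ∀ t, F (axisPoint t) = 0) (s : ℝ) (u : V (k + 1)) :
    taylorTerm 1 F s u = ∑ m : Fin k, pderiv m.succ F (axisPoint s) * u m.succ := by
  have hu : u = ∑ i, u i • basisVec i := by rw [sum_smul_basisVec]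
  rw [taylorTerm_eq, iteratedFDeriv_one_apply]
  conv_lhs => rw [hu]
  rw [map_sum, Fin.sum_univ_succ]
  have := pderiv_zero_eq_zero ((hF s).differentiableAt (by simp)) h0
  simp only [pderiv] at this ⊢
  simp [this, mul_comm]

lemma apply_eq_taylor_one (hF : ∀ t, ContDiffAt ℝ ∞ F (axisPoint t))
    (h0 : ∀ t, F (axisPoint t) = 0) (s : ℝ) (u : V (k + 1)) :
    F (axisPoint s + u) = ∑ m : Fin k, pderiv m.succ F (axisPoint s) * u m.succ
      + taylorRemainder 1 F s u := by
  simp [taylorRemainder, Finset.sum_range_succ, taylorTerm_eq 0, h0, taylorTerm_one hF h0]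

lemma apply_eq_taylor_two (hF : ∀ t, ContDiffAt ℝ ∞ F (axisPoint t))
    (h0 : ∀ t, F (axisPoint t) = 0) (s : ℝ) (u : V (k + 1)) :
    F (axisPoint s + u) = ∑ m : Fin k, pderiv m.succ F (axisPoint s) * u m.succ
      + mixedTaylor 2 F s u + taylorRemainder 2 F s u := by
  simp [taylorRemainder, Finset.sum_range_succ, taylorTerm_eq 0, h0, taylorTerm_one hF h0,
    taylorTerm_eq_mixedTaylor hF h0 s u 2]

lemma apply_eq_taylor_three (hF : ∀ t, ContDiffAt ℝ ∞ F (axisPoint t))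
    (h0 : ∀ t, F (axisPoint t) = 0) (s : ℝ) (u : V (k + 1)) :
    F (axisPoint s + u) = ∑ m : Fin k, pderiv m.succ F (axisPoint s) * u m.succ
      + mixedTaylor 2 F s u + mixedTaylor 3 F s u + taylorRemainder 3 F s u := by
  simp only [taylorRemainder, Finset.sum_range_succ, taylorTerm_eq 0, h0, taylorTerm_one hF h0,
    taylorTerm_eq_mixedTaylor hF h0 s u 2, taylorTerm_eq_mixedTaylor hF h0 s u 3,
    Finset.range_zero, Finset.sum_empty, iteratedFDeriv_zero_apply]
  ring

end Taylor

/-! ### Algebra and a sup-norm bound for the Minkowski product. -/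

section Minkowski

variable {d : ℕ}

lemma mink_smul_add_smul_add (x y : ℝ) (c a b : Fin (d + 1) → ℝ) :
    mink (x • c + a) (y • c + b) =
      x * y * mink c c + x * mink b c + y * mink a c + mink a b := by
  simp only [mink, Pi.add_apply, Pi.smul_apply, smul_eq_mul]
  have : ∀ μ : Fin d, (x * c μ.succ + a μ.succ) * (y * c μ.succ + b μ.succ) =
      x * y * (c μ.succ * c μ.succ) + x * (b μ.succ * c μ.succ) + y * (a μ.succ * c μ.succ)
        + a μ.succ * b μ.succ := fun μ => by ring
  simp only [this, Finset.sum_add_distrib, ← Finset.mul_sum]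
  ring

lemma abs_mink_le (a b : Fin (d + 1) → ℝ) : |mink a b| ≤ (d + 1) * (‖a‖ * ‖b‖) := by
  have h (μ : Fin (d + 1)) : |a μ * b μ| ≤ ‖a‖ * ‖b‖ := by
    rw [abs_mul]
    exact mul_le_mul (norm_le_pi_norm a μ) (norm_le_pi_norm b μ) (abs_nonneg _) (norm_nonneg _)
  have hs : |∑ μ : Fin d, a μ.succ * b μ.succ| ≤ d * (‖a‖ * ‖b‖) := by
    refine (Finset.abs_sum_le_sum_abs _ _).trans ?_
    refine (Finset.sum_le_card_nsmul _ _ _ fun μ _ => h μ.succ).trans ?_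
    simp
  rw [mink]
  refine (abs_add_le _ _).trans ?_
  rw [abs_neg]
  linarith [h 0]

end Minkowski

/-! ### Expansion of the wave map operator in normal coordinates. -/

section Expansion

variable {k d : ℕ}

/-- A metric on `D` in normal coordinates along the axis `x⃗ = 0`. -/
structure IsNormalAlongAxis (G : V (k + 1) → Matrix (Fin (k + 1)) (Fin (k + 1)) ℝ)
    (D : Set (V (k + 1))) : Prop where
  axis_mem : ∀ s, axisPoint s ∈ D
  contDiffAt : ∀ x ∈ D, ∀ i j l, ContDiffAt ℝ ∞ (christoffel G i j l) x
  symm : ∀ i j l, christoffel G i j l = christoffel G i l j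
  christoffel_axis : ∀ i j l s, christoffel G i j l (axisPoint s) = 0
  metric_axis : ∀ s, G (axisPoint s) = 1
  pderiv_axis : ∀ m s, pderiv m (christoffel G 0 0 0) (axisPoint s) = 0

variable {G : V (k + 1) → Matrix (Fin (k + 1)) (Fin (k + 1)) ℝ} {D : Set (V (k + 1))}

/-- On the axis the quadratic terms and the `∂₀Γ` term of the curvature vanish, and lowering the
index with the identity metric changes nothing. -/
lemma IsNormalAlongAxis.riemann_axis (hG : IsNormalAlongAxis G D) (m : Fin k) (i j : Fin (k + 1))
    (s : ℝ) : riemann G m.succ 0 j i (axisPoint s) =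
      pderiv m.succ (christoffel G i j 0) (axisPoint s) := by
  have h (p : Fin (k + 1)) : pderiv 0 (christoffel G p m.succ j) (axisPoint s) = 0 :=
    pderiv_zero_eq_zero ((hG.contDiffAt _ (hG.axis_mem s) _ _ _).differentiableAt (by simp))
      (hG.christoffel_axis _ _ _)
  simp only [riemann, hG.metric_axis, hG.christoffel_axis, h, Matrix.one_apply]
  simp [hG.symm i 0 j]

/-- The higher order part of the wave map equations in normal coordinates. -/
noncomputable def higherOrderPart (G : V (k + 1) → Matrix (Fin (k + 1)) (Fin (k + 1)) ℝ)
    (dl : Fin (d + 1) → ℝ) (i : Fin (k + 1))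
    (z : ℝ × V (k + 1) × (Fin (k + 1) → Fin (d + 1) → ℝ)) : ℝ :=
  - taylorRemainder 3 (christoffel G i 0 0) z.1 z.2.1 * mink dl dl
  - 2 * ∑ j, taylorRemainder 2 (christoffel G i j 0) z.1 z.2.1 * mink (z.2.2 j) dl
  - ∑ j, ∑ l, taylorRemainder 1 (christoffel G i j l) z.1 z.2.1 * mink (z.2.2 j) (z.2.2 l)

lemma pderiv_add_linear {e : ℕ} {f : V e → ℝ} (L : V e →ₗ[ℝ] ℝ) (x : ℝ) {y : V e}
    (hf : DifferentiableAt ℝ f y) (μ : Fin e) :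
    pderiv μ (fun z => x * L z + f z) y = x * L (basisVec μ) + pderiv μ f y := by
  have hL : HasFDerivAt (fun z => x * L z) (x • LinearMap.toContinuousLinearMap L) y :=
    (LinearMap.toContinuousLinearMap L).hasFDerivAt.const_mul x
  have h : HasFDerivAt (fun z => x * L z + f z)
      (x • LinearMap.toContinuousLinearMap L + fderiv ℝ f y) y := hL.add hf.hasFDerivAt
  rw [pderiv, h.fderiv]
  simp [pderiv]

/-- The indicator of the direction of the axis. -/
def axisIndicator (i : Fin (k + 1)) : ℝ := if i = 0 then 1 else 0

lemma perturbedMap_apply (ell : V (d + 1) →ₗ[ℝ] ℝ) (u : V (d + 1) → V (k + 1)) (i : Fin (k + 1)) :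
    (fun z => perturbedMap ell u z i) = fun z => axisIndicator i * ell z + u z i := by
  funext z
  refine Fin.cases ?_ (fun m => ?_) i <;> simp [perturbedMap, axisIndicator]

lemma differentiableAt_component {e n : ℕ} {u : V e → V n} {y : V e} (hu : DifferentiableAt ℝ u y)
    (i : Fin n) : DifferentiableAt ℝ (fun z => u z i) y :=
  (EuclideanSpace.proj (𝕜 := ℝ) i).differentiableAt.comp y hu

variable {ell : V (d + 1) →ₗ[ℝ] ℝ} {dl : Fin (d + 1) → ℝ} {u : V (d + 1) → V (k + 1)}
  {y : V (d + 1)}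

lemma grad_perturbedMap (hdl : ∀ μ, dl μ = ell (basisVec μ)) (hu : DifferentiableAt ℝ u y)
    (i : Fin (k + 1)) :
    grad (fun z => perturbedMap ell u z i) y = axisIndicator i • dl + jet u y i := by
  funext μ
  rw [grad, perturbedMap_apply, pderiv_add_linear _ _ (differentiableAt_component hu i)]
  simp [hdl, jet, grad]

/-- The first derivatives of the linear function `ell` are constants, so the second derivatives do
not see it. -/
lemma box_perturbedMap (hu : ContDiffAt ℝ 2 u y) (i : Fin (k + 1)) :
    box (fun z => perturbedMap ell u z i) y = box (fun z => u z i) y := by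
  have hev : ∀ᶠ z in 𝓝 y, DifferentiableAt ℝ u z :=
    (hu.eventually (by simp)).mono fun z hz => hz.differentiableAt (by simp)
  have h (μ : Fin (d + 1)) : pderiv μ (pderiv μ fun z => perturbedMap ell u z i) y =
      pderiv μ (pderiv μ fun z => u z i) y := by
    have h1 : (pderiv μ fun z => perturbedMap ell u z i) =ᶠ[𝓝 y]
        fun z => axisIndicator i * ell (basisVec μ) + pderiv μ (fun z => u z i) z :=
      hev.mono fun z hz => by
        rw [perturbedMap_apply, pderiv_add_linear _ _ (differentiableAt_component hz i)]
    rw [pderiv_congr h1, pderiv, fderiv_const_add]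
    rfl
  simp only [box, h]

/-- The wave map operator in normal coordinates. -/
lemma IsNormalAlongAxis.waveMapOp_eq (hG : IsNormalAlongAxis G D)
    (hdl : ∀ μ, dl μ = ell (basisVec μ)) (hu : ContDiffAt ℝ 2 u y) (i : Fin (k + 1)) :
    waveMapOp G (perturbedMap ell u) i y = box (fun z => u z i) y
      + ∑ m : Fin k, riemann G m.succ 0 0 i (axisPoint (ell y)) * u y m.succ * mink dl dl
      - nonlinearity G dl i (ell y) (u y) (jet u y)
      - higherOrderPart G dl i (ell y, u y, jet u y) := by
  have hud : DifferentiableAt ℝ u y := hu.differentiableAt (by simp)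
  set s := ell y with hs
  set p := jet u y with hp
  set v := u y with hv
  have hpt : perturbedMap ell u y = axisPoint s + v := rfl
  have hax (i j l : Fin (k + 1)) (t : ℝ) : ContDiffAt ℝ ∞ (christoffel G i j l) (axisPoint t) :=
    hG.contDiffAt _ (hG.axis_mem t) i j l
  have hquad : ∑ j, ∑ l, christoffel G i j l (axisPoint s + v) *
      mink (axisIndicator j • dl + p j) (axisIndicator l • dl + p l) =
      christoffel G i 0 0 (axisPoint s + v) * mink dl dl
      + 2 * ∑ j, christoffel G i j 0 (axisPoint s + v) * mink (p j) dl
      + ∑ j, ∑ l, christoffel G i j l (axisPoint s + v) * mink (p j) (p l) := by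
    -- In one cross term the lower indices of `Γ` are exchanged, so that both cross sums collapse to
    -- the same sum and produce the factor `2`.
    have e (j l : Fin (k + 1)) : christoffel G i j l (axisPoint s + v) *
        mink (axisIndicator j • dl + p j) (axisIndicator l • dl + p l) =
        axisIndicator j * (axisIndicator l *
          (christoffel G i j l (axisPoint s + v) * mink dl dl))
        + axisIndicator j * (christoffel G i l j (axisPoint s + v) * mink (p l) dl)
        + axisIndicator l * (christoffel G i j l (axisPoint s + v) * mink (p j) dl)
        + christoffel G i j l (axisPoint s + v) * mink (p j) (p l) := by
      rw [mink_smul_add_smul_add, hG.symm i l j]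
      ring
    simp only [e, Finset.sum_add_distrib]
    simp [axisIndicator]
    ring
  -- The order of expansion decreases as the number of factors `du` grows, so that every remainder
  -- has total degree four in `(u, ∂u)`.
  have e3 := apply_eq_taylor_three (hax i 0 0) (hG.christoffel_axis i 0 0) s v
  have e2 (j : Fin (k + 1)) := apply_eq_taylor_two (hax i j 0) (hG.christoffel_axis i j 0) s v
  have e1 (j l : Fin (k + 1)) := apply_eq_taylor_one (hax i j l) (hG.christoffel_axis i j l) s v
  have c2 : ∑ j, christoffel G i j 0 (axisPoint s + v) * mink (p j) dl =
      ∑ m : Fin k, ∑ j, pderiv m.succ (christoffel G i j 0) (axisPoint s) * v m.succ * mink (p j) dl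
      + ∑ j, mixedTaylor 2 (christoffel G i j 0) s v * mink (p j) dl
      + ∑ j, taylorRemainder 2 (christoffel G i j 0) s v * mink (p j) dl := by
    rw [Finset.sum_comm, ← Finset.sum_add_distrib, ← Finset.sum_add_distrib]
    refine Finset.sum_congr rfl fun j _ => ?_
    rw [e2 j, add_mul, add_mul, Finset.sum_mul]
  have c1 : ∑ j, ∑ l, christoffel G i j l (axisPoint s + v) * mink (p j) (p l) =
      ∑ m : Fin k, ∑ j, ∑ l,
        pderiv m.succ (christoffel G i j l) (axisPoint s) * v m.succ * mink (p j) (p l)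
      + ∑ j, ∑ l, taylorRemainder 1 (christoffel G i j l) s v * mink (p j) (p l) := by
    simp only [e1, add_mul, Finset.sum_mul, Finset.sum_add_distrib]
    congr 1
    exact (Finset.sum_comm.trans (Finset.sum_congr rfl fun j _ => Finset.sum_comm)).symm
  rw [waveMapOp, box_perturbedMap hu, hpt]
  simp only [grad_perturbedMap hdl hud]
  rw [hquad, c1, c2, e3]
  simp only [nonlinearity, higherOrderPart, hG.riemann_axis, ← Finset.sum_mul]
  ring

end Expansion

/-! ### Joint smoothness of the remainder terms in `(s, u, p)`. -/

section Smoothness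

variable {k d : ℕ} {D : Set (V (k + 1))}

lemma contDiffAt_multiDeriv {n q : ℕ} {f : V n → ℝ} {x : V n} (hf : ContDiffAt ℝ ∞ f x)
    (A : Fin q → Fin n) : ContDiffAt ℝ ∞ (multiDeriv A f) x := by
  have h := hf.iteratedFDeriv_right (m := ∞) (i := q) (by exact_mod_cast le_top)
  exact (ContinuousMultilinearMap.apply ℝ (fun _ : Fin q => V n) ℝ
    (fun a => basisVec (A a))).contDiff.contDiffAt.comp x h

lemma contDiff_axisPoint : ContDiff ℝ ∞ (axisPoint (k := k)) := by
  have h : (axisPoint : ℝ → V (k + 1)) = fun s => (0 : V (k + 1)) + s • basisVec 0 :=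
    funext axisPoint_eq_smul
  rw [h]
  fun_prop

lemma contDiffAt_taylorRemainder {f : V (k + 1) → ℝ} {z : ℝ × V (k + 1)}
    (hz : ContDiffAt ℝ ∞ f (axisPoint z.1 + z.2)) (hs : ContDiffAt ℝ ∞ f (axisPoint z.1)) (N : ℕ) :
    ContDiffAt ℝ ∞ (fun w : ℝ × V (k + 1) => taylorRemainder N f w.1 w.2) z := by
  have hax : ContDiffAt ℝ ∞ (fun w : ℝ × V (k + 1) => axisPoint (k := k) w.1) z :=
    contDiff_axisPoint.contDiffAt.comp z contDiffAt_fst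
  have hc (i : Fin (k + 1)) : ContDiffAt ℝ ∞ (fun w : ℝ × V (k + 1) => w.2 i) z :=
    (EuclideanSpace.proj (𝕜 := ℝ) i).contDiff.contDiffAt.comp z contDiffAt_snd
  unfold taylorRemainder taylorTerm
  refine (ContDiffAt.comp z hz (hax.add contDiffAt_snd)).sub
    (ContDiffAt.sum fun q _ => ContDiffAt.sum fun A _ => ?_)
  refine (contDiffAt_const.mul ?_).mul (contDiffAt_prod fun a _ => hc _)
  exact ContDiffAt.comp z (contDiffAt_multiDeriv hs A) hax

lemma contDiff_mink : ContDiff ℝ ∞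
    (fun w : (Fin (d + 1) → ℝ) × (Fin (d + 1) → ℝ) => mink w.1 w.2) := by
  unfold mink
  fun_prop

lemma contDiffOn_higherOrderPart {G : V (k + 1) → Matrix (Fin (k + 1)) (Fin (k + 1)) ℝ}
    (hG : IsNormalAlongAxis G D) (hadd : ∀ s, ∀ u ∈ D, axisPoint s + u ∈ D)
    (dl : Fin (d + 1) → ℝ) (i : Fin (k + 1)) :
    ContDiffOn ℝ ∞ (higherOrderPart G dl i) (jetDomain d D) := by
  intro z hz
  refine ContDiffAt.contDiffWithinAt ?_
  have hR (N : ℕ) (j l : Fin (k + 1)) :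
      ContDiffAt ℝ ∞ (fun w : ℝ × V (k + 1) × (Fin (k + 1) → Fin (d + 1) → ℝ) =>
        taylorRemainder N (christoffel G i j l) w.1 w.2.1) z :=
    ContDiffAt.comp z (contDiffAt_taylorRemainder (z := (z.1, z.2.1))
      (hG.contDiffAt _ (hadd _ _ hz) i j l) (hG.contDiffAt _ (hG.axis_mem _) i j l) N)
      (contDiffAt_fst.prodMk (contDiffAt_snd.fst))
  have hp (j : Fin (k + 1)) : ContDiffAt ℝ ∞
      (fun w : ℝ × V (k + 1) × (Fin (k + 1) → Fin (d + 1) → ℝ) => w.2.2 j) z := by fun_prop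
  unfold higherOrderPart
  refine (((hR 3 0 0).neg.mul contDiffAt_const).sub (contDiffAt_const.mul
    (ContDiffAt.sum fun j _ => (hR 2 j 0).mul ?_))).sub
    (ContDiffAt.sum fun j _ => ContDiffAt.sum fun l _ => (hR 1 j l).mul ?_)
  · exact contDiff_mink.contDiffAt.comp z ((hp j).prodMk contDiffAt_const)
  · exact contDiff_mink.contDiffAt.comp z ((hp j).prodMk (hp l))

end Smoothness

/-! ### Quartic bound for the higher order part, and smooth majorants. -/

section Bounds

variable {k d : ℕ}

/-- The sum of the absolute values of the derivatives of orders `2`, `3`, `4` of the Christoffel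
symbols. -/
noncomputable def derivSum (G : V (k + 1) → Matrix (Fin (k + 1)) (Fin (k + 1)) ℝ)
    (x : V (k + 1)) : ℝ :=
  ∑ i, ∑ j, ∑ l, ∑ q ∈ Finset.Icc 2 4, ∑ A : Fin q → Fin (k + 1),
    |multiDeriv A (christoffel G i j l) x|

variable {G : V (k + 1) → Matrix (Fin (k + 1)) (Fin (k + 1)) ℝ} {D : Set (V (k + 1))}

lemma abs_multiDeriv_le_derivSum {q : ℕ} (hq : q ∈ Finset.Icc 2 4) (A : Fin q → Fin (k + 1))
    (i j l : Fin (k + 1)) (x : V (k + 1)) :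
    |multiDeriv A (christoffel G i j l) x| ≤ derivSum G x := by
  have hA := Finset.single_le_sum (f := fun A : Fin q → Fin (k + 1) =>
    |multiDeriv A (christoffel G i j l) x|) (fun _ _ => abs_nonneg _) (Finset.mem_univ A)
  have hQ := Finset.single_le_sum (f := fun q => ∑ A : Fin q → Fin (k + 1),
    |multiDeriv A (christoffel G i j l) x|) (fun _ _ =>
      Finset.sum_nonneg fun _ _ => abs_nonneg _) hq
  have hl := Finset.single_le_sum (f := fun l => ∑ q ∈ Finset.Icc 2 4, ∑ A : Fin q → Fin (k + 1),
    |multiDeriv A (christoffel G i j l) x|) (fun _ _ =>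
      Finset.sum_nonneg fun _ _ => Finset.sum_nonneg fun _ _ => abs_nonneg _) (Finset.mem_univ l)
  have hj := Finset.single_le_sum (f := fun j => ∑ l, ∑ q ∈ Finset.Icc 2 4,
    ∑ A : Fin q → Fin (k + 1), |multiDeriv A (christoffel G i j l) x|)
    (fun _ _ =>
      Finset.sum_nonneg fun _ _ => Finset.sum_nonneg fun _ _ => Finset.sum_nonneg fun _ _ =>
      abs_nonneg _) (Finset.mem_univ j)
  have hi := Finset.single_le_sum (f := fun i => ∑ j, ∑ l, ∑ q ∈ Finset.Icc 2 4,
    ∑ A : Fin q → Fin (k + 1), |multiDeriv A (christoffel G i j l) x|)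
    (fun _ _ =>
      Finset.sum_nonneg fun _ _ => Finset.sum_nonneg fun _ _ =>
      Finset.sum_nonneg fun _ _ => Finset.sum_nonneg fun _ _ => abs_nonneg _) (Finset.mem_univ i)
  exact hA.trans (hQ.trans (hl.trans (hj.trans hi)))

lemma derivSum_le {K : ℝ} {x : V (k + 1)}
    (h : ∀ q : ℕ, 2 ≤ q → q ≤ 4 → ∀ (A : Fin q → Fin (k + 1)) (i j l : Fin (k + 1)),
      |multiDeriv A (christoffel G i j l) x| ≤ K) :
    derivSum G x ≤ ∑ _i : Fin (k + 1), ∑ _j : Fin (k + 1), ∑ _l : Fin (k + 1),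
      ∑ q ∈ Finset.Icc 2 4, ∑ _A : Fin q → Fin (k + 1), K := by
  refine Finset.sum_le_sum fun i _ => Finset.sum_le_sum fun j _ => Finset.sum_le_sum fun l _ =>
    Finset.sum_le_sum fun q hq => Finset.sum_le_sum fun A _ => ?_
  exact h q (Finset.mem_Icc.1 hq).1 (Finset.mem_Icc.1 hq).2 A i j l

lemma continuousOn_derivSum (hG : IsNormalAlongAxis G D) : ContinuousOn (derivSum G) D := by
  unfold derivSum
  refine continuousOn_finsetSum _ fun i _ => continuousOn_finsetSum _ fun j _ =>
    continuousOn_finsetSum _ fun l _ => continuousOn_finsetSum _ fun q _ =>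
    continuousOn_finsetSum _ fun A _ => ContinuousOn.abs fun x hx => ?_
  exact (contDiffAt_multiDeriv (hG.contDiffAt x hx i j l) A).continuousAt.continuousWithinAt

/-- Absorbs the mixed monomials `|u|³|p|` and `|u|²|p|²` coming from the terms with one and two
factors `p`. -/
lemma mul_pow_le_pow_four_add {a b : ℝ} (ha : 0 ≤ a) (hb : 0 ≤ b) :
    a ^ 3 * b ≤ a ^ 4 + b ^ 4 ∧ a ^ 2 * b ^ 2 ≤ a ^ 4 + b ^ 4 := by
  rcases le_total a b with h | h
  · have h3 : a ^ 3 * b ≤ b ^ 3 * b := by gcongr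
    have h2 : a ^ 2 * b ^ 2 ≤ b ^ 2 * b ^ 2 := by gcongr
    have : 0 ≤ a ^ 4 := by positivity
    exact ⟨by nlinarith, by nlinarith⟩
  · have h3 : a ^ 3 * b ≤ a ^ 3 * a := by gcongr
    have h2 : a ^ 2 * b ^ 2 ≤ a ^ 2 * a ^ 2 := by gcongr
    have : 0 ≤ b ^ 4 := by positivity
    exact ⟨by nlinarith, by nlinarith⟩

lemma abs_higherOrderPart_le (dl : Fin (d + 1) → ℝ) {s K : ℝ} {u : V (k + 1)}
    (hD : ∀ t ∈ Set.Icc (0 : ℝ) 1, ∀ i j l,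
      ContDiffAt ℝ ∞ (christoffel G i j l) (axisPoint s + t • u))
    (hK : ∀ t ∈ Set.Icc (0 : ℝ) 1, derivSum G (axisPoint s + t • u) ≤ K)
    (i : Fin (k + 1)) (p : Fin (k + 1) → Fin (d + 1) → ℝ) :
    |higherOrderPart G dl i (s, u, p)| ≤ ((k + 1 : ℕ) : ℝ) ^ 4 * (d + 1) * (‖dl‖ ^ 2 + 2 * ‖dl‖ + 1)
      * K * (‖u‖ ^ 4 + ‖p‖ ^ 4) := by
  have hR (N : ℕ) (hN : N + 1 ∈ Finset.Icc 2 4) (j l : Fin (k + 1)) :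
      |taylorRemainder N (christoffel G i j l) s u| ≤
        ((k + 1 : ℕ) : ℝ) ^ (N + 1) * K * ‖u‖ ^ (N + 1) :=
    abs_taylorRemainder_le (fun t ht => hD t ht i j l)
      fun t ht A => (abs_multiDeriv_le_derivSum hN A i j l _).trans (hK t ht)
  have hK0 : 0 ≤ K := by
    refine le_trans ?_ (hK 0 (by simp))
    exact (abs_nonneg _).trans
      (abs_multiDeriv_le_derivSum (q := 2) (by simp) (fun _ => 0) 0 0 0 _)
  set n : ℝ := ((k + 1 : ℕ) : ℝ) with hn
  have hn0 : 0 ≤ n := by positivity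
  have b1 : |taylorRemainder 3 (christoffel G i 0 0) s u * mink dl dl| ≤
      n ^ 4 * K * ‖u‖ ^ 4 * ((d + 1) * (‖dl‖ * ‖dl‖)) := by
    rw [abs_mul]
    exact mul_le_mul (hR 3 (by simp) 0 0) (abs_mink_le _ _) (abs_nonneg _) (by positivity)
  have b2 : |∑ j, taylorRemainder 2 (christoffel G i j 0) s u * mink (p j) dl| ≤
      n * (n ^ 3 * K * ‖u‖ ^ 3 * ((d + 1) * (‖p‖ * ‖dl‖))) := by
    refine (Finset.abs_sum_le_sum_abs _ _).trans ?_
    refine (Finset.sum_le_card_nsmul _ _ (n ^ 3 * K * ‖u‖ ^ 3 * ((d + 1) * (‖p‖ * ‖dl‖)))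
      fun j _ => ?_).trans (by simp [hn])
    rw [abs_mul]
    refine mul_le_mul (hR 2 (by simp) j 0) ((abs_mink_le _ _).trans ?_) (abs_nonneg _)
      (by positivity)
    gcongr
    exact norm_le_pi_norm p j
  have b3 : |∑ j, ∑ l, taylorRemainder 1 (christoffel G i j l) s u * mink (p j) (p l)| ≤
      n * (n * (n ^ 2 * K * ‖u‖ ^ 2 * ((d + 1) * (‖p‖ * ‖p‖)))) := by
    refine (Finset.abs_sum_le_sum_abs _ _).trans ?_
    refine (Finset.sum_le_card_nsmul _ _ (n * (n ^ 2 * K * ‖u‖ ^ 2 * ((d + 1) * (‖p‖ * ‖p‖))))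
      fun j _ => ?_).trans (by simp [hn])
    refine (Finset.abs_sum_le_sum_abs _ _).trans ?_
    refine (Finset.sum_le_card_nsmul _ _ (n ^ 2 * K * ‖u‖ ^ 2 * ((d + 1) * (‖p‖ * ‖p‖)))
      fun l _ => ?_).trans (by simp [hn])
    rw [abs_mul]
    refine mul_le_mul (hR 1 (by simp) j l) ((abs_mink_le _ _).trans ?_) (abs_nonneg _)
      (by positivity)
    gcongr
    · exact norm_le_pi_norm p j
    · exact norm_le_pi_norm p l
  obtain ⟨hm3, hm2⟩ := mul_pow_le_pow_four_add (norm_nonneg u) (norm_nonneg p)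
  set c : ℝ := n ^ 4 * (d + 1) * K with hc
  have hc0 : 0 ≤ c := by positivity
  have t1 : c * ‖dl‖ ^ 2 * ‖u‖ ^ 4 ≤ c * ‖dl‖ ^ 2 * (‖u‖ ^ 4 + ‖p‖ ^ 4) := by
    gcongr
    linarith [pow_nonneg (norm_nonneg p) 4]
  have t2 : c * ‖dl‖ * (‖u‖ ^ 3 * ‖p‖) ≤ c * ‖dl‖ * (‖u‖ ^ 4 + ‖p‖ ^ 4) := by gcongr
  have t3 : c * (‖u‖ ^ 2 * ‖p‖ ^ 2) ≤ c * (‖u‖ ^ 4 + ‖p‖ ^ 4) := by gcongr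
  have e1 : n ^ 4 * K * ‖u‖ ^ 4 * ((d + 1) * (‖dl‖ * ‖dl‖)) = c * ‖dl‖ ^ 2 * ‖u‖ ^ 4 := by ring
  have e2 : n * (n ^ 3 * K * ‖u‖ ^ 3 * ((d + 1) * (‖p‖ * ‖dl‖))) =
      c * ‖dl‖ * (‖u‖ ^ 3 * ‖p‖) := by ring
  have e3 : n * (n * (n ^ 2 * K * ‖u‖ ^ 2 * ((d + 1) * (‖p‖ * ‖p‖)))) =
      c * (‖u‖ ^ 2 * ‖p‖ ^ 2) := by ring
  rw [e1, abs_le] at b1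
  rw [e2, abs_le] at b2
  rw [e3, abs_le] at b3
  have e4 : n ^ 4 * (d + 1) * (‖dl‖ ^ 2 + 2 * ‖dl‖ + 1) * K * (‖u‖ ^ 4 + ‖p‖ ^ 4) =
      c * ‖dl‖ ^ 2 * (‖u‖ ^ 4 + ‖p‖ ^ 4) + 2 * (c * ‖dl‖ * (‖u‖ ^ 4 + ‖p‖ ^ 4))
        + c * (‖u‖ ^ 4 + ‖p‖ ^ 4) := by ring
  rw [e4]
  simp only [higherOrderPart, neg_mul]
  rw [abs_le]
  constructor <;> linarith [b1.1, b1.2, b2.1, b2.2, b3.1, b3.2]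

/-- Reduces both bounds of (c) to a majorant of `derivSum` along segments; the dimensional constants
and `‖dl‖` go into the smooth factor. -/
lemma isHigherOrder_of_derivSum_le (hG : IsNormalAlongAxis G D)
    (hseg : ∀ s, ∀ u ∈ D, ∀ t ∈ Set.Icc (0 : ℝ) 1, axisPoint s + t • u ∈ D)
    (dl : Fin (d + 1) → ℝ) {C : ℝ → ℝ} {f : V (k + 1) → ℝ} (hf : ContDiffOn ℝ ∞ f D)
    (h : ∀ s, ∀ u ∈ D, ∀ t ∈ Set.Icc (0 : ℝ) 1, derivSum G (axisPoint s + t • u) ≤ C s * f u) :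
    IsHigherOrder D C (higherOrderPart G dl) := by
  refine ⟨fun w => ((k + 1 : ℕ) : ℝ) ^ 4 * (d + 1) * (‖dl‖ ^ 2 + 2 * ‖dl‖ + 1) * f w.1,
    contDiffOn_const.mul (hf.comp contDiff_fst.contDiffOn fun w hw => hw), fun i z hz => ?_⟩
  refine (abs_higherOrderPart_le dl (fun t ht => hG.contDiffAt _ (hseg _ _ hz t ht))
    (h z.1 z.2.1 hz) i z.2.2).trans (le_of_eq ?_)
  ring

/-- Every sequence is dominated by a smooth function. -/
lemma exists_contDiff_majorant (b : ℕ → ℝ) :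
    ∃ F : ℝ → ℝ, ContDiff ℝ ∞ F ∧ ∀ x, b ⌈x⌉₊ ≤ F x := by
  -- Partition of unity: local constants in the convex sets `[b ⌈x⌉₊, ∞)` are glued. Near `x` the
  -- ceiling is at most `⌈x⌉₊ + 1`, so a finite sum of `|b j|` is such a constant.
  obtain ⟨F, hF⟩ := exists_contMDiffMap_forall_mem_convex_of_local_const (n := ⊤) 𝓘(ℝ, ℝ)
    (t := fun x : ℝ => Set.Ici (b ⌈x⌉₊)) (fun x => convex_Ici _) (fun x => by
      refine ⟨∑ j ∈ Finset.range (⌈x⌉₊ + 2), |b j|, ?_⟩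
      filter_upwards [Iio_mem_nhds (show x < x + 1 by linarith)] with y hy
      have hy' : ⌈y⌉₊ ≤ ⌈x⌉₊ + 1 := Nat.ceil_le.2 (by
        push_cast
        linarith [Nat.le_ceil x, Set.mem_Iio.1 hy])
      exact (le_abs_self _).trans (Finset.single_le_sum (f := fun j => |b j|)
        (fun _ _ => abs_nonneg _) (Finset.mem_range.2 (by lia))))
  exact ⟨F, contMDiff_iff_contDiff.1 F.contMDiff, hF⟩

end Bounds

/-! ### Compact exhaustion of the normal disc bundle and separation of variables. -/

section Disc

variable {k : ℕ}

lemma normalPart_axisPoint_add_smul (s t : ℝ) (u : V (k + 1)) :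
    normalPart (axisPoint s + t • u) = t • normalPart u := by
  ext m
  simp [normalPart]

lemma contDiff_normalPart : ContDiff ℝ ∞ (normalPart (k := k)) := by
  refine contDiff_euclidean.2 fun m => ?_
  exact (EuclideanSpace.proj (𝕜 := ℝ) m.succ).contDiff

lemma norm_axisPoint (s : ℝ) : ‖axisPoint (k := k) s‖ = |s| := by
  simp [axisPoint]

/-- The normal disc bundle of radius `r`. -/
def normalDisc (k : ℕ) (r : ENNReal) : Set (V (k + 1)) := {x | ‖normalPart x‖ₑ < r}

variable {r : ENNReal}

/-- Writing the condition with `r⁻¹` treats finite and infinite radius together: for `r = ⊤` the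
coefficient is `0`. -/
lemma mem_normalDisc_iff (hr : r ≠ 0) {x : V (k + 1)} :
    x ∈ normalDisc k r ↔ (r⁻¹).toReal * ‖normalPart x‖ < 1 := by
  change ‖normalPart x‖ₑ < r ↔ _
  rcases eq_or_ne r ⊤ with rfl | hr'
  · simp
  lift r to NNReal using hr'
  have hpos : (0 : ℝ) < r := by
    have : r ≠ 0 := by simpa using hr
    exact_mod_cast this.bot_lt
  rw [ENNReal.toReal_inv, ENNReal.coe_toReal, inv_mul_lt_one₀ hpos, enorm_eq_nnnorm,
    ENNReal.coe_lt_coe, ← NNReal.coe_lt_coe, coe_nnnorm]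

lemma segment_mem_normalDisc {u : V (k + 1)} (hu : u ∈ normalDisc k r) (s : ℝ) {t : ℝ}
    (ht : t ∈ Set.Icc (0 : ℝ) 1) : axisPoint s + t • u ∈ normalDisc k r := by
  refine lt_of_le_of_lt ?_ (show ‖normalPart u‖ₑ < r from hu)
  rw [normalPart_axisPoint_add_smul, enorm_le_iff_norm_le, norm_smul, Real.norm_eq_abs,
    abs_of_nonneg ht.1]
  exact mul_le_of_le_one_left (norm_nonneg _) ht.2

lemma add_mem_normalDisc {u : V (k + 1)} (hu : u ∈ normalDisc k r) (s : ℝ) :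
    axisPoint s + u ∈ normalDisc k r := by
  simpa using segment_mem_normalDisc hu s (t := 1) (by simp)

/-- A smooth proper function on the normal disc bundle. -/
noncomputable def exhaustion (r : ENNReal) (x : V (k + 1)) : ℝ :=
  (1 - (r⁻¹).toReal ^ 2 * ‖normalPart x‖ ^ 2)⁻¹ + ‖x‖ ^ 2

/-- A compact exhaustion of the normal disc bundle. -/
def compactPiece (k : ℕ) (r : ENNReal) (N : ℕ) : Set (V (k + 1)) :=
  {x | ‖x‖ ≤ 2 * N ∧ 1 ≤ N * (1 - (r⁻¹).toReal ^ 2 * ‖normalPart x‖ ^ 2)}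

lemma one_sub_pos (hr : r ≠ 0) {x : V (k + 1)} (hx : x ∈ normalDisc k r) :
    0 < 1 - (r⁻¹).toReal ^ 2 * ‖normalPart x‖ ^ 2 := by
  have h := (mem_normalDisc_iff hr).1 hx
  have h0 : 0 ≤ (r⁻¹).toReal * ‖normalPart x‖ := by positivity
  rw [← mul_pow]
  nlinarith

lemma contDiffOn_exhaustion (hr : r ≠ 0) :
    ContDiffOn ℝ ∞ (exhaustion (k := k) r) (normalDisc k r) := by
  unfold exhaustion
  refine ContDiffOn.add (ContDiffOn.inv ?_ fun x hx => (one_sub_pos hr hx).ne')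
    (contDiff_norm_sq ℝ).contDiffOn
  exact (contDiff_const.sub (contDiff_const.mul (contDiff_normalPart.norm_sq ℝ))).contDiffOn

lemma isCompact_compactPiece (N : ℕ) : IsCompact (compactPiece k r N) := by
  have hc := (contDiff_normalPart (k := k)).continuous
  refine Metric.isCompact_of_isClosed_isBounded ?_ ?_
  · have h1 : IsClosed {x : V (k + 1) | ‖x‖ ≤ 2 * N} := isClosed_le (by fun_prop) (by fun_prop)
    have h2 : IsClosed {x : V (k + 1) |
        1 ≤ N * (1 - (r⁻¹).toReal ^ 2 * ‖normalPart x‖ ^ 2)} :=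
      isClosed_le (by fun_prop) (by fun_prop)
    exact h1.inter h2
  · exact (Metric.isBounded_closedBall (x := (0 : V (k + 1))) (r := 2 * N)).subset
      fun x hx => by simpa using hx.1

lemma compactPiece_subset (hr : r ≠ 0) (N : ℕ) : compactPiece k r N ⊆ normalDisc k r := by
  intro x hx
  rw [mem_normalDisc_iff hr]
  have h2 := hx.2
  have hN : (0 : ℝ) ≤ N := by positivity
  have h0 : 0 ≤ (r⁻¹).toReal * ‖normalPart x‖ := by positivity
  rw [← mul_pow] at h2
  by_contra! hcon
  have h1 : 1 ≤ ((r⁻¹).toReal * ‖normalPart x‖) ^ 2 := one_le_pow₀ hcon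
  nlinarith

lemma segment_mem_compactPiece (hr : r ≠ 0) {u : V (k + 1)} (hu : u ∈ normalDisc k r) {s t : ℝ}
    (ht : t ∈ Set.Icc (0 : ℝ) 1) {N : ℕ} (hs : |s| ≤ N) (hN : exhaustion r u ≤ N) :
    axisPoint s + t • u ∈ compactPiece k r N := by
  have hpos := one_sub_pos hr hu
  have hinv : 1 ≤ (1 - (r⁻¹).toReal ^ 2 * ‖normalPart u‖ ^ 2)⁻¹ :=
    (one_le_inv₀ hpos).2 (by
      linarith [show 0 ≤ (r⁻¹).toReal ^ 2 * ‖normalPart u‖ ^ 2 by positivity])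
  have hexp : (1 - (r⁻¹).toReal ^ 2 * ‖normalPart u‖ ^ 2)⁻¹ + ‖u‖ ^ 2 ≤ N := hN
  have htu : ‖t • u‖ ≤ ‖u‖ := by
    rw [norm_smul, Real.norm_eq_abs, abs_of_nonneg ht.1]
    exact mul_le_of_le_one_left (norm_nonneg _) ht.2
  constructor
  · have := norm_add_le (axisPoint s) (t • u)
    rw [norm_axisPoint] at this
    nlinarith [sq_nonneg (‖u‖ - 1), norm_nonneg u]
  · rw [normalPart_axisPoint_add_smul]
    have hn : ‖t • normalPart u‖ ≤ ‖normalPart u‖ := by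
      rw [norm_smul, Real.norm_eq_abs, abs_of_nonneg ht.1]
      exact mul_le_of_le_one_left (norm_nonneg _) ht.2
    have h1 : 1 - (r⁻¹).toReal ^ 2 * ‖normalPart u‖ ^ 2 ≤
        1 - (r⁻¹).toReal ^ 2 * ‖t • normalPart u‖ ^ 2 := by gcongr
    have h2 : (1 - (r⁻¹).toReal ^ 2 * ‖normalPart u‖ ^ 2)⁻¹ ≤ (N : ℝ) := by
      linarith [sq_nonneg ‖u‖]
    calc (1 : ℝ) = (1 - (r⁻¹).toReal ^ 2 * ‖normalPart u‖ ^ 2)⁻¹ *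
          (1 - (r⁻¹).toReal ^ 2 * ‖normalPart u‖ ^ 2) := (inv_mul_cancel₀ hpos.ne').symm
      _ ≤ N * (1 - (r⁻¹).toReal ^ 2 * ‖t • normalPart u‖ ^ 2) := by gcongr

lemma mem_compactPiece (hr : r ≠ 0) {u : V (k + 1)} (hu : u ∈ normalDisc k r) {N : ℕ}
    (hN : exhaustion r u ≤ N) : u ∈ compactPiece k r N := by
  have h := segment_mem_compactPiece hr hu (s := 0) (t := 1) (by simp) (by simp) hN
  have h0 : axisPoint (k := k) 0 = 0 := by simp [axisPoint]
  simpa [h0] using h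

/-- A continuous function on the normal disc bundle is dominated along the segments from
`(s, 0⃗)` to `(s, 0⃗) + u` by a product `C(s) f(u)`. -/
lemma exists_product_majorant (hr : r ≠ 0) {S : V (k + 1) → ℝ}
    (hS : ContinuousOn S (normalDisc k r)) :
    ∃ C : ℝ → ℝ, Continuous C ∧ ∃ f : V (k + 1) → ℝ, ContDiffOn ℝ ∞ f (normalDisc k r) ∧
      ∀ s, ∀ u ∈ normalDisc k r, ∀ t ∈ Set.Icc (0 : ℝ) 1,
        S (axisPoint s + t • u) ≤ C s * f u := by
  have hb (N : ℕ) : ∃ b : ℝ, 0 ≤ b ∧ ∀ x ∈ compactPiece k r N, S x ≤ b := by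
    obtain ⟨b, hb⟩ := (isCompact_compactPiece N).exists_bound_of_continuousOn
      (hS.mono (compactPiece_subset hr N))
    exact ⟨|b|, abs_nonneg b, fun x hx => (le_abs_self _).trans ((hb x hx).trans (le_abs_self b))⟩
  choose b hb0 hb using hb
  obtain ⟨F, hF, hbF⟩ := exists_contDiff_majorant b
  -- For nonnegative `a`, `b` the product `(1 + a)(1 + b)` dominates both; the larger of the two
  -- ceilings indexes a compact piece containing the segment.
  refine ⟨fun s => 1 + F |s|, by have := hF.continuous; fun_prop, fun u => 1 + F (exhaustion r u),
    contDiffOn_const.add (hF.comp_contDiffOn (contDiffOn_exhaustion hr)), fun s u hu t ht => ?_⟩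
  have h1 := (hb0 _).trans (hbF |s|)
  have h2 := (hb0 _).trans (hbF (exhaustion r u))
  rcases le_total ⌈|s|⌉₊ ⌈exhaustion r u⌉₊ with h | h
  · have := hb _ _ (segment_mem_compactPiece hr hu ht
      ((Nat.le_ceil |s|).trans (by exact_mod_cast h)) (Nat.le_ceil _))
    nlinarith [hbF (exhaustion r u)]
  · have := hb _ _ (segment_mem_compactPiece hr hu ht
      (Nat.le_ceil |s|) ((Nat.le_ceil _).trans (by exact_mod_cast h)))
    nlinarith [hbF |s|]

/-- A function that is bounded on each closed disc bundle of radius `ρ < r` is dominated along the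
segments from `(s, 0⃗)` to `(s, 0⃗) + u` by a smooth function of `u`. -/
lemma exists_uniform_majorant (hr : r ≠ 0) {S : V (k + 1) → ℝ}
    (hS : ∀ ρ : NNReal, (ρ : ENNReal) < r → ∃ K : ℝ, ∀ x : V (k + 1),
      ‖normalPart x‖ₑ ≤ ρ → S x ≤ K) :
    ∃ f : V (k + 1) → ℝ, ContDiffOn ℝ ∞ f (normalDisc k r) ∧
      ∀ s, ∀ u ∈ normalDisc k r, ∀ t ∈ Set.Icc (0 : ℝ) 1, S (axisPoint s + t • u) ≤ f u := by
  have hb (N : ℕ) : ∃ b : ℝ, ∀ y ∈ compactPiece k r N, ∀ x : V (k + 1),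
      ‖normalPart x‖ ≤ ‖normalPart y‖ → S x ≤ b := by
    rcases (compactPiece k r N).eq_empty_or_nonempty with h | h
    · exact ⟨0, by simp [h]⟩
    -- The largest normal distance on the compact piece is attained, hence is still smaller than
    -- `r`, and serves as `ρ`.
    obtain ⟨y₀, hy₀, hmax⟩ := (isCompact_compactPiece N).exists_isMaxOn h
      (contDiff_normalPart (k := k)).continuous.norm.continuousOn
    obtain ⟨K, hK⟩ := hS ‖normalPart y₀‖₊ (compactPiece_subset hr N hy₀)
    exact ⟨K, fun y hy x hx => hK x (enorm_le_iff_norm_le.2 (hx.trans (hmax hy)))⟩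
  choose b hb using hb
  obtain ⟨F, hF, hbF⟩ := exists_contDiff_majorant b
  refine ⟨fun u => F (exhaustion r u), hF.comp_contDiffOn (contDiffOn_exhaustion hr),
    fun s u hu t ht => (hb _ u (mem_compactPiece hr hu (Nat.le_ceil _)) _ ?_).trans (hbF _)⟩
  rw [normalPart_axisPoint_add_smul, norm_smul, Real.norm_eq_abs, abs_of_nonneg ht.1]
  exact mul_le_of_le_one_left (norm_nonneg _) ht.2

end Disc

/-! ### The Fermi metric is normal along the axis. -/

section Fermi

variable {k : ℕ} {M : Type*} [TopologicalSpace M] [T2Space M] [ChartedSpace (V (k + 1)) M]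
  [IsManifold (𝓡 (k + 1)) ∞ M] {g : Metric (k + 1) M} {γ : ℝ → M}
  {e : Fin (k + 1) → ∀ t, TangentSpace (𝓡 (k + 1)) (γ t)}

theorem isNormalAlongAxis_fermiMetric (hg : IsComplete g) (hγ : IsGeodesic g γ)
    (he : IsFermiFrame g γ e) (hr : focalRadius g γ e ≠ 0) :
    IsNormalAlongAxis (fermiMetric g γ e) (fermiDomain g γ e) := by
  have hD (s : ℝ) : axisPoint s ∈ fermiDomain g γ e := by
    change ‖normalPart (axisPoint s)‖ₑ < _
    simpa using hr.bot_lt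
  have hΓ := fermi_christoffel_axisPoint hg hγ he hD
  have hone := fermiMetric_axisPoint hg hγ he hD
  refine ⟨hD, fun x hx => contDiffAt_fermi_christoffel hx,
    christoffel_symm (pullbackMetric_symm g _), fun i j l s => hΓ s i j l, hone, fun m s => ?_⟩
  exact pderiv_christoffel_zero_zero_zero (fun s => contDiffAt_fermiMetric (hD s)) hone
    (fun s => pderiv_metric_eq_zero (pullbackMetric_symm g _) (det_fermiMetric_ne_zero (hD s))
      (hΓ s)) m s

end Fermi

end FermiWaveMap

/-! ### The proposition. -/

open FermiWaveMap in
theorem proposition3p2 {k d : ℕ} {M : Type*} [TopologicalSpace M] [T2Space M]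
    [ChartedSpace (V (k + 1)) M] [IsManifold (𝓡 (k + 1)) ∞ M]
    (g : FermiWaveMap.Metric (k + 1) M) (hg : FermiWaveMap.IsComplete g)
    (γ : ℝ → M) (hγ : IsGeodesic g γ)
    (e : Fin (k + 1) → ∀ t, TangentSpace (𝓡 (k + 1)) (γ t)) (he : IsFermiFrame g γ e)
    (ell : V (d + 1) →ₗ[ℝ] ℝ) (dl : Fin (d + 1) → ℝ) (hdl : ∀ μ, dl μ = ell (basisVec μ)) :
    -- all pure `x¹`-derivatives of the Christoffel symbols vanish along the geodesic
    (∀ s : ℝ, axisPoint s ∈ fermiDomain g γ e → ∀ (q : ℕ) (i j l : Fin (k + 1)),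
      multiDeriv (fun _ : Fin q => (0 : Fin (k + 1)))
        (christoffel (fermiMetric g γ e) i j l) (axisPoint s) = 0) ∧
    ∃ h : Fin (k + 1) → ℝ × V (k + 1) × (Fin (k + 1) → Fin (d + 1) → ℝ) → ℝ,
      -- `h` is smooth and of higher order
      (∀ i, ContDiffOn ℝ ∞ (h i) (jetDomain d (fermiDomain g γ e))) ∧
      (∃ C : ℝ → ℝ, Continuous C ∧ IsHigherOrder (fermiDomain g γ e) C h) ∧
      -- with a uniform constant if the Christoffel symbols have uniformly bounded derivatives
      ((∀ ρ : NNReal, (ρ : ENNReal) < focalRadius g γ e → ∃ K : ℝ, ∀ x : V (k + 1),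
          ‖normalPart x‖ₑ ≤ ρ → ∀ q : ℕ, 2 ≤ q → q ≤ 4 → ∀ (A : Fin q → Fin (k + 1))
          (i j l : Fin (k + 1)), |multiDeriv A (christoffel (fermiMetric g γ e) i j l) x| ≤ K) →
        ∃ C : ℝ, IsHigherOrder (fermiDomain g γ e) (fun _ => C) h) ∧
      -- the wave map equations for `φ = (ℓ + u¹, u⃗)` are the wave and Klein-Gordon equations
      ∀ (u : V (d + 1) → V (k + 1)) (y : V (d + 1)),
        ContDiffAt ℝ 2 u y → u y ∈ fermiDomain g γ e →
        (waveMapOp (fermiMetric g γ e) (perturbedMap ell u) 0 y = 0 ↔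
          box (fun z => u z 0) y
            = nonlinearity (fermiMetric g γ e) dl 0 (ell y) (u y) (jet u y)
              + h 0 (ell y, u y, jet u y)) ∧
        ∀ i : Fin k,
          (waveMapOp (fermiMetric g γ e) (perturbedMap ell u) i.succ y = 0 ↔
            box (fun z => u z i.succ) y
              + ∑ m : Fin k, riemann (fermiMetric g γ e) m.succ 0 0 i.succ (axisPoint (ell y))
                  * u y m.succ * mink dl dl
              = nonlinearity (fermiMetric g γ e) dl i.succ (ell y) (u y) (jet u y)
                + h i.succ (ell y, u y, jet u y)) := by
  -- For focal radius zero the coordinate domain is empty and every claim is vacuous.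
  rcases eq_or_ne (focalRadius g γ e) 0 with hr | hr
  · have hempty (x : V (k + 1)) : x ∉ fermiDomain g γ e := fun hx => by
      have hx' : ‖normalPart x‖ₑ < focalRadius g γ e := hx
      simp [hr] at hx'
    refine ⟨fun s hs => absurd hs (hempty _), fun _ _ => 0, fun _ => contDiffOn_const,
      ⟨0, continuous_const, 0, contDiffOn_const, fun _ _ hz => absurd hz (hempty _)⟩,
      fun _ => ⟨0, 0, contDiffOn_const, fun _ _ hz => absurd hz (hempty _)⟩,
      fun u y _ huy => absurd huy (hempty _)⟩
  have hG := isNormalAlongAxis_fermiMetric hg hγ he hr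
  have hseg (s : ℝ) (u : V (k + 1)) (hu : u ∈ fermiDomain g γ e) (t : ℝ)
      (ht : t ∈ Set.Icc (0 : ℝ) 1) : axisPoint s + t • u ∈ fermiDomain g γ e :=
    segment_mem_normalDisc hu s ht
  refine ⟨fun s _ q i j l => multiDeriv_zero_eq_zero
      (fun t => hG.contDiffAt _ (hG.axis_mem t) i j l) (hG.christoffel_axis i j l) q s,
    higherOrderPart (fermiMetric g γ e) dl,
    contDiffOn_higherOrderPart hG (fun s u hu => add_mem_normalDisc hu s) dl, ?_, fun hK => ?_,
    fun u y hu _ => ?_⟩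
  · obtain ⟨C, hC, f, hf, h⟩ := exists_product_majorant hr (continuousOn_derivSum hG)
    exact ⟨C, hC, isHigherOrder_of_derivSum_le hG hseg dl hf h⟩
  · obtain ⟨f, hf, h⟩ := exists_uniform_majorant (S := derivSum (fermiMetric g γ e)) hr
      fun ρ hρ => by
      obtain ⟨K, hK⟩ := hK ρ hρ
      exact ⟨_, fun x hx => derivSum_le (hK x hx)⟩
    -- The constant `1` suffices, since the majorant `f` carries all the size.
    exact ⟨1, isHigherOrder_of_derivSum_le hG hseg dl hf fun s u hu t ht => by
      rw [one_mul]
      exact h s u hu t ht⟩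
  · have h := hG.waveMapOp_eq hdl hu
    refine ⟨?_, fun i => ?_⟩
    -- The would-be mass term has coefficient `R_{m000} = ∂ₘΓ⁰₀₀ = 0` on the axis.
    · have h0 := h 0
      simp only [hG.riemann_axis, hG.pderiv_axis, zero_mul, Finset.sum_const_zero] at h0
      rw [h0]
      constructor <;> intro h' <;> linarith
    · rw [h i.succ]
      constructor <;> intro h' <;> linarith
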